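/- Let $r\ge 1$ and let $S:\mathbb R^{r+1}\to\mathbb R$ be a local energy of range $r$: $S$ is $C^2$ and $S(\xi_1,\dots,\xi_{r+1})=\sum_{j=1}^r f_j(\xi_1,\xi_{j+1})$, where the functions $f_j\in C^2(\mathbb R^2)$ satisfy 1. $f_j(\nu+1,\mu+1)=f_j(\nu,\mu)$; 2. there is $K>0$ with $\|\partial_{i}\partial_k f_j\|_{\sup}\le K/r$ for all $j$ and all $i,k\in\{1,2\}$; 3. $f_j(\nu,\mu)\to\infty$ as $|\nu-\mu|\to\infty$; 4. there is $\lambda>0$ with $\partial_1\partial_2f_j(\nu,\mu)\le-\lambda$ for all $j$ and all $\nu,\mu\in\mathbb R$. For $x\in\mathbb R^{\mathbb Z}$ and $i\in\mathbb Z$ put $S_i(x)=S(x_i,\dots,x_{i+r})$, and for finite $B\subset\mathbb Z$ put $W_B(x)=\sum_{i\in B}S_i(x)$. A sequence $x\in\mathbb R^{\mathbb Z}$ is a global minimizer if $W_B(x)\le W_B(x+v)$ for all integers $i_0\le i_1$, with $B=[i_0-r,i_1]$, and all $v\in\mathbb R^{\mathbb Z}$ supported in $[i_0,i_1]$. For $k,l\in\mathbb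 Z$ let $(\tau_{k,l}x)_i=x_{i-k}+l$. The sequence $x$ is Birkhoff if for all $k,l\in\mathbb Z$ either $\tau_{k,l}x\le x$ or $\tau_{k,l}x\ge x$ (pointwise). The domain of crossing of two sequences $x,y$ is the minimal interval $D\subset\mathbb Z$ (possibly empty or infinite) to both sides of which $x$ and $y$ are weakly ordered: if $D$ has a least element $j_0$, then $x\le y$ or $y\le x$ on $(-\infty,j_0]$; if $D$ has a greatest element $j_1$, then $x\le y$ or $y\le x$ on $[j_1,\infty)$; and $D=\varnothing$ if $x\le y$ or $y\le x$ on all of $\mathbb Z$. (Minimality is with respect to inclusion; a minimal interval always exists, and if there are several, then all of them are one-point sets.) A global minimizer $x$ is almost Birkhoff if for all $k,l\in\mathbb Z$ the domain of crossing of $x$ and $\tau_{k,l}x$ is finite. Theorem. Every almost Birkhoff global minimizer is Birkhoff. Consequently the set $\mathcal{ABM}$ of almost Birkhoff global minimizers is equal to the set $\mathcal{BM}$ of Birkhoff global minimizers. -/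

import Mathlib

open Filter

namespace MonotoneRecurrence

noncomputable section

/-- The first partial derivative `∂₁ f` of a function of two real variables. -/
def pderiv1 (f : ℝ → ℝ → ℝ) : ℝ → ℝ → ℝ := fun a b => deriv (fun t => f t b) a

/-- The second partial derivative `∂₂ f` of a function of two real variables. -/
def pderiv2 (f : ℝ → ℝ → ℝ) : ℝ → ℝ → ℝ := fun a b => deriv (fun t => f a t) b

/-- `S : ℝ^(r+1) → ℝ` is a local energy of range `r ≥ 1`: a `C²` function of the form
`S(ξ₀, …, ξᵣ) = ∑_{j=1}^r f_j(ξ₀, ξ_j)`, where the `f_j` are `C²`, periodic, have uniformly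
bounded second derivatives, are coercive and satisfy the strong twist condition.
(The index `j : Fin r` stands for the interaction of `ξ₀` with `ξ_(j+1)`.) -/
def IsLocalEnergy (r : ℕ) (S : (Fin (r + 1) → ℝ) → ℝ) : Prop :=
  1 ≤ r ∧ ContDiff ℝ 2 S ∧
  ∃ f : Fin r → ℝ → ℝ → ℝ,
    (∀ j, ContDiff ℝ 2 (fun p : ℝ × ℝ => f j p.1 p.2)) ∧
    (∀ ξ, S ξ = ∑ j : Fin r, f j (ξ 0) (ξ j.succ)) ∧
    -- periodicity
    (∀ j a b, f j (a + 1) (b + 1) = f j a b) ∧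
    -- uniform bound on the second derivatives
    (∃ K : ℝ, 0 < K ∧ ∀ j a b,
      |pderiv1 (pderiv1 (f j)) a b| ≤ K / r ∧ |pderiv1 (pderiv2 (f j)) a b| ≤ K / r ∧
      |pderiv2 (pderiv1 (f j)) a b| ≤ K / r ∧ |pderiv2 (pderiv2 (f j)) a b| ≤ K / r) ∧
    -- coercivity: `f_j(a, b) → ∞` as `|a - b| → ∞`
    (∀ j, Tendsto (fun p : ℝ × ℝ => f j p.1 p.2)
      (comap (fun p : ℝ × ℝ => |p.1 - p.2|) atTop) atTop) ∧
    -- strong twist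
    (∃ lam : ℝ, 0 < lam ∧ ∀ j a b, pderiv1 (pderiv2 (f j)) a b ≤ -lam)

/-- `S_j(x) = S(x_j, …, x_{j+r})`. -/
def siteEnergy {r : ℕ} (S : (Fin (r + 1) → ℝ) → ℝ) (j : ℤ) (x : ℤ → ℝ) : ℝ :=
  S (fun i => x (j + (i : ℕ)))

/-- `W_B(x) = ∑_{i ∈ B} S_i(x)` for a finite `B ⊂ ℤ`. -/
def energyOn {r : ℕ} (S : (Fin (r + 1) → ℝ) → ℝ) (B : Finset ℤ) (x : ℤ → ℝ) : ℝ :=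
  ∑ i ∈ B, siteEnergy S i x

/-- Global minimizers: for every segment `B = [i₀ - r, i₁]`, `i₀ ≤ i₁`, and every variation `v`
supported in the interior `[i₀, i₁]` of `B`, one has `W_B(x) ≤ W_B(x + v)`. -/
def IsGlobalMinimizer {r : ℕ} (S : (Fin (r + 1) → ℝ) → ℝ) (x : ℤ → ℝ) : Prop :=
  ∀ i₀ i₁ : ℤ, i₀ ≤ i₁ → ∀ v : ℤ → ℝ, Function.support v ⊆ Set.Icc i₀ i₁ →
    energyOn S (Finset.Icc (i₀ - r) i₁) x ≤ energyOn S (Finset.Icc (i₀ - r) i₁) (x + v)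

/-- The translation `(τ_{k,l} x)_i = x_{i-k} + l`. -/
def translate (k l : ℤ) (x : ℤ → ℝ) : ℤ → ℝ := fun i => x (i - k) + l

/-- The Birkhoff property: `x` is weakly ordered with respect to all its translates. -/
def IsBirkhoff (x : ℤ → ℝ) : Prop :=
  ∀ k l : ℤ, translate k l x ≤ x ∨ x ≤ translate k l x

/-- `x` and `y` are weakly ordered on the set `A` of indices. -/
def OrderedOn (x y : ℤ → ℝ) (A : Set ℤ) : Prop :=
  (∀ i ∈ A, x i ≤ y i) ∨ (∀ i ∈ A, y i ≤ x i)

/-- `D` is a domain of crossing of `x` and `y`: an interval of `ℤ` that is minimal (for inclusion)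
among the intervals to the left and to the right of which `x` and `y` are weakly ordered.
For `D = [j₀, j₁]` we have `lowerBounds D = (-∞, j₀]` and `upperBounds D = [j₁, ∞)`; at an infinite
end of `D` there is no condition, as the corresponding set of bounds is empty; and for `D = ∅` both
sets are all of `ℤ`, so the condition is that `x` and `y` are ordered. -/
def IsDomainOfCrossing (x y : ℤ → ℝ) (D : Set ℤ) : Prop :=
  Minimal (fun E : Set ℤ => E.OrdConnected ∧
    OrderedOn x y (lowerBounds E) ∧ OrderedOn x y (upperBounds E)) D

/-- The set of almost Birkhoff global minimizers: for all `k, l` the domain of crossing of `x` and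
`τ_{k,l} x` is finite. -/
def almostBirkhoffMinimizers {r : ℕ} (S : (Fin (r + 1) → ℝ) → ℝ) : Set (ℤ → ℝ) :=
  {x | IsGlobalMinimizer S x ∧
    ∀ k l : ℤ, ∃ D : Set ℤ, IsDomainOfCrossing x (translate k l x) D ∧ D.Finite}

/-- The set of Birkhoff global minimizers. -/
def birkhoffMinimizers {r : ℕ} (S : (Fin (r + 1) → ℝ) → ℝ) : Set (ℤ → ℝ) :=
  {x | IsGlobalMinimizer S x ∧ IsBirkhoff x}

end

end MonotoneRecurrence

namespace MonotoneRecurrence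

/-! The twist condition makes the energy submodular: passing from two sequences to their pointwise
minimum and maximum never raises the total. It also gives a strong comparison principle,
`eq_of_isSiteMinimizer`. Together they yield `le_of_splice`: if minimizers satisfy x ≤ y near -∞,
and far to the right x ⊓ y and x ⊔ y can be glued to x and y at arbitrarily small cost, then x ⊓ y
is a site minimizer touching x on the left, so it equals x. The gluing is free if x ≤ y near +∞ as
well, and cheap if x and y come close on windows of r sites arbitrarily far out.

A finite domain of crossing orders x and y = τ_{k,l} x near both ends. If the two orders agree,
comparison applies directly. Otherwise let k > 0, with x ≤ y on the left and y ≤ x on the right (the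
other case is this one for -x). Then x_i - (l/k) i does not decrease along steps of k towards either
end. By `asymptotic_or_unbounded`, at each end either x and y come close on windows, and comparison
applies, or x_i - (l/k) i tends to +∞. If it diverges at both ends, x lies above every z + n outside
a finite segment, where z is a periodic minimizer of slope l/k (`exists_periodic_isBondMinimizer`).
Comparison puts x above every z + n everywhere, which is absurd. -/

/-- Interaction potentials `f j`, `j : Fin r`, that are smooth, periodic, coercive, and satisfy the
integrated form of the strong twist condition. -/
structure IsTwistFamily {r : ℕ} (f : Fin r → ℝ → ℝ → ℝ) (lam : ℝ) : Prop where
  differentiable : ∀ j, Differentiable ℝ (fun p : ℝ × ℝ => f j p.1 p.2)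
  periodic : ∀ j a b, f j (a + 1) (b + 1) = f j a b
  coercive : ∀ j C, ∃ R, ∀ a b, R ≤ |a - b| → C ≤ f j a b
  pos : 0 < lam
  twist : ∀ j a b h k, 0 ≤ h → 0 ≤ k →
    f j (a + h) (b + k) + f j a b + lam * h * k ≤ f j (a + h) b + f j a (b + k)

/-- The twist condition on `∂₁∂₂f` in integrated form. -/
theorem twist_of_pderiv {f : ℝ → ℝ → ℝ} {lam : ℝ}
    (hf : ContDiff ℝ 2 (fun p : ℝ × ℝ => f p.1 p.2))
    (ht : ∀ a b, pderiv1 (pderiv2 f) a b ≤ -lam) (a b h k : ℝ) (hh : 0 ≤ h) (hk : 0 ≤ k) :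
    f (a + h) (b + k) + f a b + lam * h * k ≤ f (a + h) b + f a (b + k) := by
  have hd : Differentiable ℝ (fun p : ℝ × ℝ => f p.1 p.2) := hf.differentiable (by norm_num)
  have hs : ∀ a b, HasDerivAt (fun t => f a t)
      (fderiv ℝ (fun p : ℝ × ℝ => f p.1 p.2) (a, b) (0, 1)) b := fun a b =>
    (hd (a, b)).hasFDerivAt.comp_hasDerivAt (f := fun t : ℝ => (a, t)) b
      ((hasDerivAt_const b a).prodMk (hasDerivAt_id b))
  have h2 : ∀ a b, pderiv2 f a b = fderiv ℝ (fun p : ℝ × ℝ => f p.1 p.2) (a, b) (0, 1) :=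
    fun a b => (hs a b).deriv
  have hC : ContDiff ℝ 1 (fderiv ℝ (fun p : ℝ × ℝ => f p.1 p.2)) :=
    hf.fderiv_right (by norm_num)
  have hd1 : ∀ b, Differentiable ℝ (fun t => pderiv2 f t b) := by
    intro b
    have : (fun t => pderiv2 f t b) =
        fun t => fderiv ℝ (fun p : ℝ × ℝ => f p.1 p.2) (t, b) (0, 1) := funext fun t => h2 t b
    rw [this]
    have := hC.differentiable (by norm_num)
    exact fun t => ((this (t, b)).comp t
      (f := fun t : ℝ => (t, b)) (by fun_prop)).clm_apply (by fun_prop)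
  -- Mean value inequality in the first variable; a second one, for t ↦ f (a + h) t - f a t, gives
  -- the mixed second difference.
  have step : ∀ s, pderiv2 f (a + h) s - pderiv2 f a s ≤ -lam * h := by
    intro s
    have := image_sub_le_mul_sub_of_deriv_le (hd1 s) (C := -lam) (fun t => ht t s)
      (show a ≤ a + h by linarith)
    simpa using this
  have hg : ∀ s, HasDerivAt (fun t => f (a + h) t - f a t)
      (pderiv2 f (a + h) s - pderiv2 f a s) s := fun s => by
    rw [h2, h2]; exact (hs _ _).sub (hs _ _)
  have := image_sub_le_mul_sub_of_deriv_le (f := fun t => f (a + h) t - f a t)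
    (fun s => (hg s).differentiableAt) (C := -lam * h)
    (fun s => by rw [(hg s).deriv]; exact step s) (show b ≤ b + k by linarith)
  simp only [add_sub_cancel_left] at this
  linarith

/-! ### Bond energies and minimizers -/

/-- The energy of all bonds `(i, i + j + 1)` that meet, or jump over, the segment `[A, B]`. -/
noncomputable def bondEnergy {r : ℕ} (f : Fin r → ℝ → ℝ → ℝ) (A B : ℤ) (x : ℤ → ℝ) : ℝ :=
  ∑ j : Fin r, ∑ i ∈ Finset.Icc (A - (j + 1)) B, f j (x i) (x (i + (j + 1)))

/-- `x` minimizes the energy with respect to variations supported in any segment. -/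
def IsBondMinimizer {r : ℕ} (f : Fin r → ℝ → ℝ → ℝ) (x : ℤ → ℝ) : Prop :=
  ∀ A B : ℤ, ∀ y : ℤ → ℝ, (∀ i, i < A ∨ B < i → y i = x i) →
    bondEnergy f A B x ≤ bondEnergy f A B y

/-- `x` minimizes the energy with respect to variations of a single coordinate. -/
def IsSiteMinimizer {r : ℕ} (f : Fin r → ℝ → ℝ → ℝ) (x : ℤ → ℝ) : Prop :=
  ∀ (s : ℤ) (t : ℝ), bondEnergy f s s x ≤ bondEnergy f s s (Function.update x s t)

variable {r : ℕ} {f : Fin r → ℝ → ℝ → ℝ} {lam : ℝ}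

theorem IsBondMinimizer.isSiteMinimizer {x : ℤ → ℝ} (hx : IsBondMinimizer f x) :
    IsSiteMinimizer f x := fun s t => hx s s _ fun i hi => by
  rw [Function.update_of_ne]; omega

/-- Only the bonds counted in `bondEnergy f A B` see a variation supported in `[A, B]`. -/
theorem sum_sub_eq_bondEnergy_sub {A B : ℤ} {x y : ℤ → ℝ} (T : Finset ℤ)
    (hT : ∀ j : Fin r, Finset.Icc (A - (j + 1)) B ⊆ T)
    (h : ∀ i, i < A ∨ B < i → y i = x i) :
    (∑ j : Fin r, ∑ i ∈ T, f j (y i) (y (i + (j + 1)))) -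
      (∑ j : Fin r, ∑ i ∈ T, f j (x i) (x (i + (j + 1)))) =
    bondEnergy f A B y - bondEnergy f A B x := by
  unfold bondEnergy
  simp only [← Finset.sum_sub_distrib]
  refine Finset.sum_congr rfl fun j _ => (Finset.sum_subset (hT j) fun i _ hi => ?_).symm
  rw [Finset.mem_Icc] at hi
  rw [h i (by omega), h (i + (j + 1)) (by omega), sub_self]

theorem bondEnergy_sub_eq {A B A' B' : ℤ} {x y : ℤ → ℝ} (hA : A' ≤ A) (hB : B ≤ B')
    (h : ∀ i, i < A ∨ B < i → y i = x i) :
    bondEnergy f A' B' y - bondEnergy f A' B' x = bondEnergy f A B y - bondEnergy f A B x := by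
  rw [← sum_sub_eq_bondEnergy_sub (Finset.Icc (A' - r) B') (fun j => Finset.Icc_subset_Icc
    (by have := j.2; omega) hB) h, ← sum_sub_eq_bondEnergy_sub (Finset.Icc (A' - r) B')
    (fun j => Finset.Icc_subset_Icc (by have := j.2; omega) le_rfl)
    (fun i hi => h i (by omega))]

/-! ### Symmetries -/

theorem IsTwistFamily.periodic_int (hf : IsTwistFamily f lam) (j : Fin r) (a b : ℝ) (l : ℤ) :
    f j (a + l) (b + l) = f j a b := by
  induction l using Int.induction_on with
  | zero => simp
  | succ n ih => push_cast at ih ⊢; rw [← add_assoc, ← add_assoc, hf.periodic, ih]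
  | pred n ih =>
    push_cast at ih ⊢
    rw [← hf.periodic, ← ih]; congr 1 <;> ring_nf

theorem bondEnergy_translate (hf : IsTwistFamily f lam) (A B k l : ℤ) (x : ℤ → ℝ) :
    bondEnergy f A B (translate k l x) = bondEnergy f (A - k) (B - k) x := by
  unfold bondEnergy translate
  refine Finset.sum_congr rfl fun j _ => Finset.sum_nbij' (· - k) (· + k) ?_ ?_ ?_ ?_ ?_
  · intro i hi; simp only [Finset.mem_Icc] at hi ⊢; omega
  · intro i hi; simp only [Finset.mem_Icc] at hi ⊢; omega
  · intro i _; simp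
  · intro i _; simp
  · intro i _
    rw [hf.periodic_int]; congr 2; ring

theorem IsBondMinimizer.translate (hf : IsTwistFamily f lam) {x : ℤ → ℝ}
    (hx : IsBondMinimizer f x) (k l : ℤ) : IsBondMinimizer f (translate k l x) := by
  intro A B y hy
  have h := hx (A - k) (B - k) (MonotoneRecurrence.translate (-k) (-l) y) fun i hi => by
    unfold MonotoneRecurrence.translate at hy ⊢
    rw [hy _ (by omega)]; push_cast; simp
  rw [bondEnergy_translate hf] at h ⊢
  simpa using h

/-- The family describing the reflected sequences `i ↦ x (-i)`. -/
theorem IsTwistFamily.swap (hf : IsTwistFamily f lam) :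
    IsTwistFamily (fun j a b => f j b a) lam where
  differentiable j := (hf.differentiable j).comp (g := fun p : ℝ × ℝ => f j p.1 p.2)
    (f := fun p : ℝ × ℝ => (p.2, p.1)) (by fun_prop)
  periodic j a b := hf.periodic j b a
  coercive j C := by
    obtain ⟨R, hR⟩ := hf.coercive j C
    exact ⟨R, fun a b h => hR b a (by rwa [abs_sub_comm])⟩
  pos := hf.pos
  twist j a b h k hh hk := by
    have := hf.twist j b a k h hk hh
    linarith

theorem bondEnergy_reflect (A B : ℤ) (x : ℤ → ℝ) :
    bondEnergy (fun j a b => f j b a) A B (fun i => x (-i)) = bondEnergy f (-B) (-A) x := by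
  unfold bondEnergy
  refine Finset.sum_congr rfl fun j _ => Finset.sum_nbij' (fun i => -i - (j + 1))
    (fun i => -i - (j + 1)) ?_ ?_ ?_ ?_ ?_
  · intro i hi; simp only [Finset.mem_Icc] at hi ⊢; omega
  · intro i hi; simp only [Finset.mem_Icc] at hi ⊢; omega
  · intro i _; simp
  · intro i _; simp
  · intro i _
    dsimp only
    rw [show -(i + ((j : ℤ) + 1)) = -i - (j + 1) by ring,
      show -i - ((j : ℤ) + 1) + (j + 1) = -i by ring]

theorem IsBondMinimizer.reflect {x : ℤ → ℝ} (hx : IsBondMinimizer f x) :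
    IsBondMinimizer (fun j a b => f j b a) (fun i => x (-i)) := by
  intro A B y hy
  have h := hx (-B) (-A) (fun i => y (-i)) fun i hi => by
    simpa using hy (-i) (by omega)
  have e := bondEnergy_reflect (f := f) A B (fun i => y (-i))
  simp only [neg_neg] at e
  rwa [bondEnergy_reflect, e]

/-! ### Submodularity and the strong comparison principle -/

theorem IsTwistFamily.twist_le (hf : IsTwistFamily f lam) (j : Fin r) {a a' b b' : ℝ}
    (ha : a ≤ a') (hb : b ≤ b') :
    f j a' b' + f j a b + lam * (a' - a) * (b' - b) ≤ f j a' b + f j a b' := by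
  simpa using hf.twist j a b (a' - a) (b' - b) (sub_nonneg.2 ha) (sub_nonneg.2 hb)

/-- If the two pairs are ordered alike, minimum and maximum only permute the terms; if oppositely,
this is the twist inequality on a rectangle with its nonnegative gain dropped. -/
theorem IsTwistFamily.min_add_max_le (hf : IsTwistFamily f lam) (j : Fin r) (a b c d : ℝ) :
    f j (min a c) (min b d) + f j (max a c) (max b d) ≤ f j a b + f j c d := by
  have key : ∀ {a a' b b' : ℝ}, a ≤ a' → b ≤ b' → f j a' b' + f j a b ≤ f j a' b + f j a b' :=
    fun {a a' b b'} ha hb => by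
      have := hf.twist_le j ha hb
      have : 0 ≤ lam * (a' - a) * (b' - b) :=
        mul_nonneg (mul_nonneg hf.pos.le (sub_nonneg.2 ha)) (sub_nonneg.2 hb)
      linarith
  rcases le_total a c with h | h <;> rcases le_total b d with h' | h' <;>
    simp only [h, h', min_eq_left, min_eq_right, max_eq_left, max_eq_right]
  · exact le_rfl
  · linarith [key h h']
  · linarith [key h h']
  · linarith

theorem bondEnergy_inf_add_sup_le (hf : IsTwistFamily f lam) (A B : ℤ) (x y : ℤ → ℝ) :
    bondEnergy f A B (x ⊓ y) + bondEnergy f A B (x ⊔ y) ≤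
      bondEnergy f A B x + bondEnergy f A B y := by
  unfold bondEnergy
  simp only [← Finset.sum_add_distrib]
  exact Finset.sum_le_sum fun j _ => Finset.sum_le_sum fun i _ => hf.min_add_max_le j _ _ _ _

theorem differentiable_bondEnergy_update (hf : IsTwistFamily f lam) (A B s : ℤ) (x : ℤ → ℝ) :
    Differentiable ℝ fun t => bondEnergy f A B (Function.update x s t) := by
  have hu : ∀ i, Differentiable ℝ fun t : ℝ => Function.update x s t i := by
    intro i
    by_cases h : i = s
    · subst h; simp
    · simp [Function.update_of_ne h]
  unfold bondEnergy
  refine Differentiable.fun_sum fun j _ => Differentiable.fun_sum fun i _ => ?_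
  exact (hf.differentiable j).comp (g := fun p : ℝ × ℝ => f j p.1 p.2) ((hu i).prodMk (hu _))

/-- Raising a common coordinate costs less for the larger configuration. -/
theorem bondEnergy_update_sub_le (hf : IsTwistFamily f lam) (hr : 1 ≤ r) {m x : ℤ → ℝ}
    (hmx : m ≤ x) {s : ℤ} (hs : m s = x s) {h : ℝ} (hh : 0 ≤ h) {n : ℤ}
    (hn : n = s + 1 ∨ n = s - 1) :
    bondEnergy f s s (Function.update x s (x s + h)) - bondEnergy f s s x + lam * (x n - m n) * h ≤
      bondEnergy f s s (Function.update m s (x s + h)) - bondEnergy f s s m := by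
  have term : ∀ (j : Fin r) (i : ℤ),
      f j (Function.update x s (x s + h) i) (Function.update x s (x s + h) (i + (j + 1)))
        - f j (x i) (x (i + (j + 1)))
        + (if i = s then lam * (x (i + (j + 1)) - m (i + (j + 1))) * h
          else if i + (j + 1) = s then lam * (x i - m i) * h else 0) ≤
      f j (Function.update m s (x s + h) i) (Function.update m s (x s + h) (i + (j + 1)))
        - f j (m i) (m (i + (j + 1))) := by
    intro j i
    by_cases h1 : i = s
    · subst h1
      have hne : i + ((j : ℤ) + 1) ≠ i := by omega
      have := hf.twist_le j (show x i ≤ x i + h by linarith) (hmx (i + (j + 1)))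
      simp only [Function.update_self, Function.update_of_ne hne, hs, if_true]
      linarith
    · by_cases h2 : i + (j + 1) = s
      · have := hf.twist_le j (hmx i) (show x s ≤ x s + h by linarith)
        simp only [h2, Function.update_self, Function.update_of_ne h1, hs, if_true, if_neg h1]
        linarith
      · rw [if_neg h1, if_neg h2, Function.update_of_ne h1, Function.update_of_ne h1,
          Function.update_of_ne h2, Function.update_of_ne h2]
        simp
  have hpos : ∀ k, 0 ≤ lam * (x k - m k) * h := fun k =>
    mul_nonneg (mul_nonneg hf.pos.le (sub_nonneg.2 (hmx k))) hh
  have hpos' : ∀ (j : Fin r) (i : ℤ), 0 ≤ (if i = s then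
      lam * (x (i + (j + 1)) - m (i + (j + 1))) * h
      else if i + (j + 1) = s then lam * (x i - m i) * h else 0) := by
    intro j i; split_ifs <;> simp [hpos]
  have total := Finset.sum_le_sum fun j (_ : j ∈ (Finset.univ : Finset (Fin r))) =>
    Finset.sum_le_sum fun i (_ : i ∈ Finset.Icc (s - ((j : ℤ) + 1)) s) => term j i
  simp only [Finset.sum_add_distrib, Finset.sum_sub_distrib] at total
  refine le_trans (add_le_add le_rfl ?_) total
  -- All gains are nonnegative, so it suffices to keep the nearest-neighbour bond joining s and n.
  refine le_trans ?_ (Finset.single_le_sum (fun j _ => Finset.sum_nonneg fun i _ => hpos' j i)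
    (Finset.mem_univ (⟨0, hr⟩ : Fin r)))
  rcases hn with rfl | rfl
  · refine le_trans (le_of_eq ?_) (Finset.single_le_sum (fun i _ => hpos' _ i)
      (show s ∈ _ by simp))
    simp
  · refine le_trans (le_of_eq ?_) (Finset.single_le_sum (fun i _ => hpos' _ i)
      (show s - 1 ∈ _ by simp))
    simp

/-- As a function of the value at s, the energy of m has zero derivative at the common value.
Minimality of x and `bondEnergy_update_sub_le` bound its right slope below by lam * (x n - m n), so
the gap at n vanishes. -/
theorem eq_of_isSiteMinimizer_of_adjacent (hf : IsTwistFamily f lam) (hr : 1 ≤ r) {m x : ℤ → ℝ}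
    (hm : IsSiteMinimizer f m) (hx : IsSiteMinimizer f x) (hmx : m ≤ x) {s : ℤ} (hs : m s = x s)
    {n : ℤ} (hn : n = s + 1 ∨ n = s - 1) : m n = x n := by
  refine le_antisymm (hmx n) ?_
  set g : ℝ → ℝ := fun t => bondEnergy f s s (Function.update m s t) with hg
  have hd : HasDerivAt g 0 (x s) := by
    have hmin : IsLocalMin g (x s) := Filter.Eventually.of_forall fun t => by
      have := hm s t
      simpa [hg, ← hs] using this
    have h := (differentiable_bondEnergy_update hf s s s m (x s)).hasDerivAt
    rwa [show deriv g (x s) = 0 from hmin.deriv_eq_zero] at h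
  have key : ∀ h, 0 ≤ h → lam * (x n - m n) * h ≤ g (x s + h) - g (x s) := by
    intro h hh
    have h1 := bondEnergy_update_sub_le hf hr hmx hs hh hn
    have h2 := hx s (x s + h)
    have h3 : g (x s) = bondEnergy f s s m := by simp [hg, ← hs]
    rw [h3]; simp only [hg]; linarith
  have hlim : Tendsto (fun h => h⁻¹ • (g (x s + h) - g (x s))) (nhdsWithin 0 (Set.Ioi 0))
      (nhds 0) :=
    hd.tendsto_slope_zero.mono_left (nhdsWithin_mono _ fun t (ht : 0 < t) => ht.ne')
  have : lam * (x n - m n) ≤ 0 := by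
    refine ge_of_tendsto hlim ?_
    filter_upwards [self_mem_nhdsWithin] with h hh
    have hh' : (0 : ℝ) < h := hh
    rw [smul_eq_mul, inv_mul_eq_div, le_div_iff₀ hh']
    exact key h hh'.le
  have := nonpos_of_mul_nonpos_right this hf.pos
  linarith

/-- Strong comparison principle: ordered site minimizers that touch are equal. -/
theorem eq_of_isSiteMinimizer (hf : IsTwistFamily f lam) (hr : 1 ≤ r) {m x : ℤ → ℝ}
    (hm : IsSiteMinimizer f m) (hx : IsSiteMinimizer f x) (hmx : m ≤ x) {s : ℤ}
    (hs : m s = x s) : m = x := by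
  funext i
  induction i using Int.inductionOn' (b := s) with
  | zero => exact hs
  | succ k _ ih => exact eq_of_isSiteMinimizer_of_adjacent hf hr hm hx hmx ih (.inl rfl)
  | pred k _ ih => exact eq_of_isSiteMinimizer_of_adjacent hf hr hm hx hmx ih (.inr rfl)

/-! ### Gluing -/

/-- The sequence that is `p` up to `n` and `q` from `n + 1` on. -/
def splice (n : ℤ) (p q : ℤ → ℝ) : ℤ → ℝ := fun i => if i ≤ n then p i else q i

/-- For each of the r potentials at most r bonds cross the cut, each costing at most η extra; all
other counted bonds are unchanged. -/
theorem bondEnergy_splice_le {A n : ℤ} {p q : ℤ → ℝ} {η : ℝ} (hη : 0 ≤ η)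
    (h : ∀ (j : Fin r) (i : ℤ), i ≤ n → n < i + (j + 1) →
      f j (p i) (q (i + (j + 1))) ≤ f j (p i) (p (i + (j + 1))) + η) :
    bondEnergy f A n (splice n p q) ≤ bondEnergy f A n p + r * (r * η) := by
  unfold bondEnergy
  have step : ∀ j : Fin r, ∑ i ∈ Finset.Icc (A - (j + 1)) n,
      f j (splice n p q i) (splice n p q (i + (j + 1))) ≤
      ∑ i ∈ Finset.Icc (A - ((j : ℤ) + 1)) n, f j (p i) (p (i + (j + 1))) + r * η := by
    intro j
    have hj := j.2
    have : ∑ i ∈ Finset.Icc (A - ((j : ℤ) + 1)) n, (if n < i + (j + 1) then η else 0) ≤ r * η := by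
      rw [← Finset.sum_filter, Finset.sum_const, nsmul_eq_mul]
      refine mul_le_mul_of_nonneg_right ?_ hη
      have hsub : (Finset.Icc (A - ((j : ℤ) + 1)) n).filter (fun i => n < i + (j + 1)) ⊆
          Finset.Icc (n + 1 - r) n := by
        intro i hi
        simp only [Finset.mem_filter, Finset.mem_Icc] at hi ⊢
        omega
      have := Finset.card_le_card hsub
      rw [Int.card_Icc] at this
      exact_mod_cast this.trans (by omega)
    refine le_trans ?_ (add_le_add le_rfl this)
    rw [← Finset.sum_add_distrib]
    refine Finset.sum_le_sum fun i hi => ?_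
    have hin : i ≤ n := (Finset.mem_Icc.1 hi).2
    by_cases hc : n < i + (j + 1)
    · simp only [splice, if_pos hin, if_neg (not_le.2 hc), if_pos hc]
      exact h j i hin hc
    · simp only [splice, if_pos hin, if_pos (not_lt.1 hc), if_neg hc, add_zero, le_refl]
  refine (Finset.sum_le_sum fun j _ => step j).trans (le_of_eq ?_)
  rw [Finset.sum_add_distrib, Finset.sum_const, Finset.card_univ, Fintype.card_fin, nsmul_eq_mul]

/-- If `x ≤ y` near `-∞` and near `+∞` one can pass cheaply from `x ⊓ y` to `x` and from `x ⊔ y` to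
`y`, then `x ≤ y`. -/
theorem le_of_splice (hf : IsTwistFamily f lam) (hr : 1 ≤ r) {x y : ℤ → ℝ}
    (hx : IsBondMinimizer f x) (hy : IsBondMinimizer f y) {a : ℤ} (hl : ∀ i < a, x i ≤ y i)
    (hg : ∀ η > 0, ∀ N : ℤ, ∃ n ≥ N, ∀ (j : Fin r) (i : ℤ), i ≤ n → n < i + (j + 1) →
      f j ((x ⊓ y) i) (x (i + (j + 1))) ≤ f j ((x ⊓ y) i) ((x ⊓ y) (i + (j + 1))) + η ∧
      f j ((x ⊔ y) i) (y (i + (j + 1))) ≤ f j ((x ⊔ y) i) ((x ⊔ y) (i + (j + 1))) + η) :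
    x ≤ y := by
  have hml : ∀ i < a, (x ⊓ y) i = x i := fun i hi => inf_eq_left.2 (hl i hi)
  have hMl : ∀ i < a, (x ⊔ y) i = y i := fun i hi => sup_eq_right.2 (hl i hi)
  have hm : IsSiteMinimizer f (x ⊓ y) := by
    intro s t
    refine le_of_forall_pos_le_add fun ε hε => ?_
    have hr0 : (0 : ℝ) < r := by exact_mod_cast hr
    -- Two gluings, each costing at most r * (r * η), must add up to ε.
    set η := ε / (2 * (r * r)) with hηdef
    have hη : 0 < η := by positivity
    have hηε : 2 * (r * (r * η)) = ε := by rw [hηdef]; field_simp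
    -- With the cut at least r beyond s, no bond crossing it sees the changed coordinate.
    obtain ⟨n, hn, hgl⟩ := hg η hη (max (s + r) a)
    have hns : s + r ≤ n := (le_max_left _ _).trans hn
    set A := min a s with hA
    have hAa : A ≤ a := min_le_left _ _
    have hAs : A ≤ s := min_le_right _ _
    set w := Function.update (x ⊓ y) s t with hw
    have hwne : ∀ i, i ≠ s → w i = (x ⊓ y) i := fun i hi => Function.update_of_ne hi _ _
    have h1 : bondEnergy f A n x ≤ bondEnergy f A n (splice n w x) := by
      refine hx A n _ fun i hi => ?_
      unfold splice
      split_ifs with hin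
      · rw [hwne i (by omega), hml i (by omega)]
      · rfl
    have h2 : bondEnergy f A n (splice n w x) ≤ bondEnergy f A n w + r * (r * η) := by
      refine bondEnergy_splice_le hη.le fun j i hin hni => ?_
      have := j.2
      rw [hwne i (by omega), hwne _ (by omega)]
      exact (hgl j i hin hni).1
    have h3 : bondEnergy f A n y ≤ bondEnergy f A n (splice n (x ⊔ y) y) := by
      refine hy A n _ fun i hi => ?_
      unfold splice
      split_ifs with hin
      · rw [hMl i (by omega)]
      · rfl
    have h4 : bondEnergy f A n (splice n (x ⊔ y) y) ≤ bondEnergy f A n (x ⊔ y) + r * (r * η) :=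
      bondEnergy_splice_le hη.le fun j i hin hni => (hgl j i hin hni).2
    have h5 := bondEnergy_inf_add_sup_le hf A n x y
    have h6 : bondEnergy f A n w - bondEnergy f A n (x ⊓ y) =
        bondEnergy f s s w - bondEnergy f s s (x ⊓ y) :=
      bondEnergy_sub_eq hAs (by omega) fun i hi => hwne i (by omega)
    -- On [A, n]: E(x ⊓ y) + E(x ⊔ y) ≤ E(x) + E(y) ≤ E(w) + E(x ⊔ y) + ε. The term E(x ⊔ y)
    -- cancels, and `h6` localizes the rest to s.
    linarith
  have := eq_of_isSiteMinimizer hf hr hm hx.isSiteMinimizer inf_le_left (hml (a - 1) (by omega))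
  exact inf_eq_left.1 this

/-! ### Comparison from the behaviour at the ends -/

theorem le_of_le_off_finite (hf : IsTwistFamily f lam) (hr : 1 ≤ r) {x y : ℤ → ℝ}
    (hx : IsBondMinimizer f x) (hy : IsBondMinimizer f y) {a b : ℤ} (hl : ∀ i < a, x i ≤ y i)
    (hb : ∀ i > b, x i ≤ y i) : x ≤ y := by
  -- Beyond b the minimum is x and the maximum is y, so the gluing is free.
  refine le_of_splice hf hr hx hy hl fun η hη N => ⟨max N b, le_max_left _ _, fun j i _ hi => ?_⟩
  have h := hb (i + (j + 1)) (lt_of_le_of_lt (le_max_right _ _) hi)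
  rw [Pi.inf_apply x y (i + _), Pi.sup_apply x y (i + _), inf_eq_left.2 h, sup_eq_right.2 h]
  constructor <;> linarith

/-- Diagonal periodicity moves a into [0, 1); the bounds on |a - b| and |b - b'| then confine
everything to a compact rectangle. -/
theorem IsTwistFamily.uniform_continuity (hf : IsTwistFamily f lam) (R : ℝ) {η : ℝ} (hη : 0 < η) :
    ∃ δ > 0, ∀ (j : Fin r) (a b b' : ℝ), |a - b| ≤ R → |b - b'| ≤ δ →
      f j a b ≤ f j a b' + η := by
  have h1 : ∀ j : Fin r, ∃ δ > 0, ∀ a b b' : ℝ, |a - b| ≤ R → |b - b'| ≤ δ →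
      f j a b ≤ f j a b' + η := by
    intro j
    have hK : IsCompact (Set.Icc (0 : ℝ) 1 ×ˢ Set.Icc (-R - 2) (R + 2)) :=
      isCompact_Icc.prod isCompact_Icc
    have hu := hK.uniformContinuousOn_of_continuous (hf.differentiable j).continuous.continuousOn
    rw [Metric.uniformContinuousOn_iff] at hu
    obtain ⟨δ, hδ, hu⟩ := hu η hη
    refine ⟨min (δ / 2) 1, by positivity, fun a b b' hab hbb => ?_⟩
    rw [← hf.periodic_int j a b (-⌊a⌋), ← hf.periodic_int j a b' (-⌊a⌋)]
    have e1 := Int.floor_le a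
    have e2 := Int.lt_floor_add_one a
    have hb1 := hbb.trans (min_le_right _ _)
    have hb2 := hbb.trans (min_le_left _ _)
    rw [abs_le] at hab hb1
    push_cast
    have := hu (a + -⌊a⌋, b + -⌊a⌋) ⟨⟨by simp only; linarith, by simp only; linarith⟩,
      ⟨by simp only; linarith, by simp only; linarith⟩⟩ (a + -⌊a⌋, b' + -⌊a⌋)
      ⟨⟨by simp only; linarith, by simp only; linarith⟩,
      ⟨by simp only; linarith, by simp only; linarith⟩⟩
      (by rw [Prod.dist_eq, dist_self, dist_add_right, Real.dist_eq]
          exact max_lt hδ (by linarith))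
    rw [Real.dist_eq] at this
    linarith [(abs_lt.1 this).2]
  choose δ hδ h using h1
  obtain ⟨d, hd, hd0⟩ := ((eventually_all.2 fun j => Ioc_mem_nhdsGT (hδ j)).and
    (self_mem_nhdsWithin : Set.Ioi (0 : ℝ) ∈ nhdsWithin 0 (Set.Ioi 0))).exists
  exact ⟨d, hd0, fun j a b b' hab hbb => h j a b b' hab (hbb.trans (hd j).2)⟩

theorem abs_sub_le_of_step {x : ℤ → ℝ} {C : ℝ} {N : ℤ}
    (h : ∀ i ≥ N, |x (i + 1) - x i| ≤ C) {i : ℤ} (hi : N ≤ i) (m : ℕ) :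
    |x i - x (i + m)| ≤ m * C := by
  induction m with
  | zero => simp
  | succ m ih =>
    have := h (i + m) (by omega)
    have h3 := abs_sub_le (x i) (x (i + m)) (x (i + (m + 1 : ℕ)))
    rw [abs_sub_comm, add_assoc] at this
    push_cast at h3 ⊢
    linarith

/-- Bounded steps and bounded distance keep the bonds crossing a cut of bounded length, so uniform
continuity makes the gluing cheap when x and y are close on the r sites after the cut. Such windows
need only recur; convergence is not required. -/
theorem le_of_asymptotic_right (hf : IsTwistFamily f lam) (hr : 1 ≤ r) {x y : ℤ → ℝ}
    (hx : IsBondMinimizer f x) (hy : IsBondMinimizer f y) {a : ℤ} (hl : ∀ i < a, x i ≤ y i)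
    {C : ℝ} {N₀ : ℤ} (hxy : ∀ i ≥ N₀, |x i - y i| ≤ C) (hd : ∀ i ≥ N₀, |x (i + 1) - x i| ≤ C)
    (hw : ∀ δ > 0, ∀ N : ℤ, ∃ n ≥ N, ∀ i, n < i → i ≤ n + r → |x i - y i| ≤ δ) : x ≤ y := by
  refine le_of_splice hf hr hx hy hl fun η hη N => ?_
  obtain ⟨δ, hδ, hc⟩ := hf.uniform_continuity (r * C + C + C) hη
  obtain ⟨n, hn, hw⟩ := hw δ hδ (max N (N₀ + r))
  have hC : 0 ≤ C := (abs_nonneg _).trans (hd N₀ le_rfl)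
  refine ⟨n, (le_max_left _ _).trans hn, fun j i hin hni => ?_⟩
  have hn' := (le_max_right _ _).trans hn
  have hj := j.2
  set k := i + ((j : ℤ) + 1) with hk
  have hik := abs_sub_le_of_step hd (show N₀ ≤ i by omega) (j + 1)
  push_cast at hik
  rw [← hk] at hik
  have hjr : ((j : ℕ) + 1 : ℝ) * C ≤ r * C := mul_le_mul_of_nonneg_right (by exact_mod_cast hj) hC
  have hi1 := hxy i (by omega)
  have hk1 := hxy k (by omega)
  have hwk := hw k hni (by omega)
  rw [abs_le] at hik hi1 hk1
  simp only [Pi.inf_apply, Pi.sup_apply]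
  rw [abs_le] at hwk
  constructor
  · refine hc j _ _ _ ?_ ?_
    · rcases le_total (x i) (y i) with h | h <;> simp only [h, inf_of_le_left, inf_of_le_right] <;>
        rw [abs_le] <;> constructor <;> linarith
    · rcases le_total (x k) (y k) with h | h <;> simp only [h, inf_of_le_left, inf_of_le_right] <;>
        rw [abs_le] <;> constructor <;> linarith
  · refine hc j _ _ _ ?_ ?_
    · rcases le_total (x i) (y i) with h | h <;> simp only [h, sup_of_le_left, sup_of_le_right] <;>
        rw [abs_le] <;> constructor <;> linarith
    · rcases le_total (x k) (y k) with h | h <;> simp only [h, sup_of_le_left, sup_of_le_right] <;>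
        rw [abs_le] <;> constructor <;> linarith

theorem le_of_asymptotic_left (hf : IsTwistFamily f lam) (hr : 1 ≤ r) {x y : ℤ → ℝ}
    (hx : IsBondMinimizer f x) (hy : IsBondMinimizer f y) {b : ℤ} (hl : ∀ i > b, x i ≤ y i)
    {C : ℝ} {N₀ : ℤ} (hxy : ∀ i ≤ N₀, |x i - y i| ≤ C) (hd : ∀ i ≤ N₀, |x (i - 1) - x i| ≤ C)
    (hw : ∀ δ > 0, ∀ N : ℤ, ∃ n ≤ N, ∀ i, n - r ≤ i → i < n → |x i - y i| ≤ δ) : x ≤ y := by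
  have := le_of_asymptotic_right hf.swap hr hx.reflect hy.reflect (a := -b)
    (fun i hi => hl (-i) (by omega)) (C := C) (N₀ := -N₀) (fun i hi => hxy (-i) (by omega))
    (fun i hi => by rw [neg_add']; exact hd (-i) (by omega))
    (fun δ hδ N => by
      obtain ⟨n, hn, h⟩ := hw δ hδ (-N)
      exact ⟨-n, by omega, fun i h1 h2 => h (-i) (by omega) (by omega)⟩)
  intro i
  simpa using this (-i)

/-! ### Periodic minimizers -/

/-- `z` is invariant under the translation `τ_{Q,P}`. -/
def IsPeriodicSeq (Q P : ℤ) (z : ℤ → ℝ) : Prop := ∀ i, z (i + Q) = z i + P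

/-- The energy over the period `[a, a + Q)`. -/
noncomputable def periodEnergy (f : Fin r → ℝ → ℝ → ℝ) (a : ℤ) (Q : ℕ) (z : ℤ → ℝ) : ℝ :=
  ∑ j : Fin r, ∑ t ∈ Finset.range Q, f j (z (a + t)) (z (a + t + (j + 1)))

/-- `z` minimizes the energy per period among the sequences that are invariant under `τ_{Q,P}`. -/
def IsPeriodicMinimizer (f : Fin r → ℝ → ℝ → ℝ) (Q : ℕ) (P : ℤ) (z : ℤ → ℝ) : Prop :=
  IsPeriodicSeq Q P z ∧ ∀ w, IsPeriodicSeq Q P w → periodEnergy f 0 Q z ≤ periodEnergy f 0 Q w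

theorem IsPeriodicSeq.mul {Q P : ℤ} {z : ℤ → ℝ} (hz : IsPeriodicSeq Q P z) (n : ℤ) :
    IsPeriodicSeq (n * Q) (n * P) z := by
  intro i
  induction n using Int.induction_on with
  | zero => simp
  | succ n ih =>
    rw [show i + ((n : ℤ) + 1) * Q = (i + n * Q) + Q by ring, hz, ih]; push_cast; ring
  | pred n ih =>
    have := hz (i + (-(n : ℤ) - 1) * Q)
    rw [show i + (-(n : ℤ) - 1) * Q + Q = i + -(n : ℤ) * Q by ring, ih] at this
    push_cast at this ⊢; linarith

theorem sum_range_shift_of_periodic {g : ℤ → ℝ} {Q : ℕ} (hg : ∀ i, g (i + Q) = g i) (a : ℤ) :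
    ∑ t ∈ Finset.range Q, g (a + t) = ∑ t ∈ Finset.range Q, g (0 + t) := by
  have step : ∀ a : ℤ, ∑ t ∈ Finset.range Q, g (a + 1 + t) = ∑ t ∈ Finset.range Q, g (a + t) := by
    intro a
    have h1 := Finset.sum_range_succ (fun t : ℕ => g (a + t)) Q
    have h2 := Finset.sum_range_succ' (fun t : ℕ => g (a + t)) Q
    have h3 : ∀ t : ℕ, g (a + (t + 1 : ℕ)) = g (a + 1 + t) := fun t => by
      congr 1; push_cast; ring
    simp only [h3] at h2
    rw [hg, h2] at h1
    simpa using h1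
  induction a using Int.induction_on with
  | zero => rfl
  | succ n ih => rw [step, ih]
  | pred n ih => rw [← ih, ← step]; simp

theorem sum_range_mul_of_periodic {g : ℤ → ℝ} {Q : ℕ} (hg : ∀ i, g (i + Q) = g i) (n : ℕ) :
    ∑ t ∈ Finset.range (n * Q), g (0 + t) = n * ∑ t ∈ Finset.range Q, g (0 + t) := by
  induction n with
  | zero => simp
  | succ n ih =>
    rw [add_mul, one_mul, Finset.sum_range_add, ih]
    have := sum_range_shift_of_periodic hg ((n * Q : ℕ) : ℤ)
    have h3 : ∀ t : ℕ, g (0 + (n * Q + t : ℕ)) = g ((n * Q : ℕ) + t) := fun t => by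
      congr 1; push_cast; ring
    simp only [h3, this]
    push_cast; ring

theorem IsPeriodicSeq.bond (hf : IsTwistFamily f lam) {Q P : ℤ} {z : ℤ → ℝ}
    (hz : IsPeriodicSeq Q P z) (j : Fin r) (i : ℤ) :
    f j (z (i + Q)) (z (i + Q + (j + 1))) = f j (z i) (z (i + (j + 1))) := by
  rw [show i + Q + ((j : ℤ) + 1) = i + (j + 1) + Q by ring, hz, hz, hf.periodic_int]

theorem periodEnergy_shift (hf : IsTwistFamily f lam) {Q : ℕ} {P : ℤ} {z : ℤ → ℝ}
    (hz : IsPeriodicSeq Q P z) (a : ℤ) : periodEnergy f a Q z = periodEnergy f 0 Q z :=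
  Finset.sum_congr rfl fun j _ => sum_range_shift_of_periodic
    (g := fun i => f j (z i) (z (i + (j + 1)))) (fun i => hz.bond hf j i) a

theorem periodEnergy_mul (hf : IsTwistFamily f lam) {Q : ℕ} {P : ℤ} {z : ℤ → ℝ}
    (hz : IsPeriodicSeq Q P z) (n : ℕ) :
    periodEnergy f 0 (n * Q) z = n * periodEnergy f 0 Q z := by
  unfold periodEnergy
  rw [Finset.mul_sum]
  exact Finset.sum_congr rfl fun j _ => sum_range_mul_of_periodic
    (g := fun i => f j (z i) (z (i + (j + 1)))) (fun i => hz.bond hf j i) n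

theorem periodEnergy_translate (hf : IsTwistFamily f lam) {Q : ℕ} {P : ℤ} {z : ℤ → ℝ}
    (hz : IsPeriodicSeq Q P z) (k l : ℤ) :
    periodEnergy f 0 Q (translate k l z) = periodEnergy f 0 Q z := by
  rw [← periodEnergy_shift hf hz (-k)]
  unfold periodEnergy translate
  refine Finset.sum_congr rfl fun j _ => Finset.sum_congr rfl fun t _ => ?_
  rw [hf.periodic_int]; congr 2 <;> ring

theorem IsPeriodicSeq.translate {Q P : ℤ} {z : ℤ → ℝ} (hz : IsPeriodicSeq Q P z) (k l : ℤ) :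
    IsPeriodicSeq Q P (translate k l z) := by
  intro i
  unfold MonotoneRecurrence.translate
  rw [show i + Q - k = i - k + Q by ring, hz]; ring

theorem sum_range_add_eq_sum_Icc (g : ℤ → ℝ) (a : ℤ) (Q : ℕ) :
    ∑ t ∈ Finset.range Q, g (a + t) = ∑ i ∈ Finset.Icc a (a + Q - 1), g i := by
  refine Finset.sum_nbij' (fun t => a + t) (fun i => (i - a).toNat) ?_ ?_ ?_ ?_ ?_
  · intro t ht; simp only [Finset.mem_range, Finset.mem_Icc] at ht ⊢; omega
  · intro i hi; simp only [Finset.mem_range, Finset.mem_Icc] at hi ⊢; omega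
  · intro t _; simp
  · intro i hi; simp only [Finset.mem_Icc] at hi ⊢; omega
  · intro t _; rfl

/-- Periodic minimizers minimize the energy on segments that are short compared to the period. -/
theorem IsPeriodicMinimizer.bondEnergy_le (hf : IsTwistFamily f lam) {Q : ℕ} {P : ℤ} {z : ℤ → ℝ}
    (hz : IsPeriodicMinimizer f Q P z) {A B : ℤ} (hAB : A ≤ B) (hQ : B - A + r < Q) {y : ℤ → ℝ}
    (hy : ∀ i, i < A ∨ B < i → y i = z i) : bondEnergy f A B z ≤ bondEnergy f A B y := by
  -- The variation y - z continued with period Q. It agrees with y on [B + 1 - Q, B + r], which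
  -- contains both ends of every bond starting in the period [B + 1 - Q, B].
  set v : ℤ → ℝ := fun i => z i + (y (A + (i - A) % Q) - z (A + (i - A) % Q)) with hv
  have hvper : IsPeriodicSeq Q P v := by
    intro i
    simp only [hv]
    rw [hz.1 i, show i + (Q : ℤ) - A = i - A + Q by ring, Int.add_emod_right]
    ring
  have hvy : ∀ i, B + 1 - Q ≤ i → i ≤ B + r → v i = y i := by
    intro i h1 h2
    simp only [hv]
    rcases lt_or_ge i A with h | h
    · have : (i - A) % (Q : ℤ) = i - A + Q := by
        rw [← Int.add_emod_right, Int.emod_eq_of_lt] <;> omega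
      rw [this, hy i (.inl h), hy _ (.inr (by omega))]; ring
    · rw [Int.emod_eq_of_lt (by omega) (by omega)]
      rw [add_sub_cancel]; ring
  have h1 := hz.2 v hvper
  rw [← periodEnergy_shift hf hz.1 (B + 1 - Q), ← periodEnergy_shift hf hvper (B + 1 - Q)] at h1
  have h2 : periodEnergy f (B + 1 - Q) Q v = periodEnergy f (B + 1 - Q) Q y := by
    refine Finset.sum_congr rfl fun j _ => Finset.sum_congr rfl fun t ht => ?_
    have := j.2
    have := Finset.mem_range.1 ht
    rw [hvy _ (by omega) (by omega), hvy _ (by omega) (by omega)]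
  have h3 : ∀ w, periodEnergy f (B + 1 - Q) Q w = ∑ j : Fin r, ∑ i ∈ Finset.Icc (B + 1 - Q) B,
      f j (w i) (w (i + (j + 1))) := by
    intro w
    refine Finset.sum_congr rfl fun j _ => ?_
    rw [sum_range_add_eq_sum_Icc (fun i => f j (w i) (w (i + (j + 1))))]
    congr 2; ring
  have h4 := sum_sub_eq_bondEnergy_sub (f := f) (Finset.Icc (B + 1 - Q) B) (fun j =>
    Finset.Icc_subset_Icc (by have := j.2; omega) le_rfl) hy
  rw [← h3, ← h3] at h4
  linarith

theorem periodEnergy_inf_add_sup_le (hf : IsTwistFamily f lam) (Q : ℕ) (x y : ℤ → ℝ) :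
    periodEnergy f 0 Q (x ⊓ y) + periodEnergy f 0 Q (x ⊔ y) ≤
      periodEnergy f 0 Q x + periodEnergy f 0 Q y := by
  unfold periodEnergy
  simp only [← Finset.sum_add_distrib]
  exact Finset.sum_le_sum fun j _ => Finset.sum_le_sum fun i _ => hf.min_add_max_le j _ _ _ _

/-- Periodic minimizers of period `(nk, nl)` have period `(k, l)`. -/
theorem IsPeriodicMinimizer.isPeriodicSeq (hf : IsTwistFamily f lam) (hr : 1 ≤ r) {n k : ℕ} {l : ℤ}
    {z : ℤ → ℝ} (hn : r < n * k) (hz : IsPeriodicMinimizer f (n * k) (n * l) z) :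
    IsPeriodicSeq k l z := by
  have site : ∀ w, IsPeriodicMinimizer f (n * k) (n * l) w → IsSiteMinimizer f w :=
    fun w hw s t => hw.bondEnergy_le hf le_rfl (by push_cast; rw [sub_self]; exact_mod_cast by omega)
      fun i hi => by rw [Function.update_of_ne]; omega
  set w := MonotoneRecurrence.translate k l z with hw
  have hwper := hz.1.translate k l
  rw [← hw] at hwper
  have hwE : periodEnergy f 0 (n * k) w = periodEnergy f 0 (n * k) z :=
    periodEnergy_translate hf hz.1 k l
  have hinf : IsPeriodicSeq (n * k : ℕ) (n * l) (z ⊓ w) := fun i => by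
    simp only [Pi.inf_apply, hz.1 i, hwper i, min_add_add_right]
  have hsup : IsPeriodicSeq (n * k : ℕ) (n * l) (z ⊔ w) := fun i => by
    simp only [Pi.sup_apply, hz.1 i, hwper i, max_add_add_right]
  have hm : IsPeriodicMinimizer f (n * k) (n * l) (z ⊓ w) := ⟨hinf, fun u hu => by
    have h1 := periodEnergy_inf_add_sup_le hf (n * k) z w
    have h2 := hz.2 _ hsup
    have h3 := hz.2 _ hu
    linarith⟩
  -- Aubry's argument: the minimum is again a periodic minimizer, so it equals z as soon as it
  -- touches z; otherwise w < z everywhere.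
  have hord : z ≤ w ∨ w ≤ z := by
    by_cases h : ∃ s, (z ⊓ w) s = z s
    · obtain ⟨s, hs⟩ := h
      exact .inl (inf_eq_left.1 (eq_of_isSiteMinimizer hf hr (site _ hm) (site _ hz) inf_le_left hs))
    · push Not at h
      refine .inr fun i => ?_
      by_contra hc
      exact h i (inf_eq_left.2 (le_of_lt (not_le.1 hc)))
  have hper : ∀ i, z (i + (n : ℤ) * k) = z i + n * l := fun i => by
    have := hz.1 i; push_cast at this; exact this
  have hn0 : 0 < n := Nat.pos_of_ne_zero fun h => by simp [h] at hn
  have ewi : ∀ i, w (i + k) = z i + l := fun i => by simp [hw, MonotoneRecurrence.translate]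
  intro i
  rcases hord with h | h
  -- Applying the order n times must reproduce the exact period (n * k, n * l), so no inequality on
  -- the way is strict.
  · have mono : ∀ (m : ℕ) (i : ℤ), z (i + (m : ℤ) * k) ≤ z i + m * l := by
      intro m i
      induction m with
      | zero => simp
      | succ m ih =>
        have := h (i + (m : ℤ) * k + k)
        rw [ewi] at this
        rw [show i + ((m + 1 : ℕ) : ℤ) * k = i + m * k + k by push_cast; ring]
        push_cast; linarith
    refine le_antisymm (by have := h (i + k); rwa [ewi] at this) ?_
    have h1 := mono (n - 1) (i + k)
    rw [Nat.cast_sub hn0, Nat.cast_sub hn0, show i + (k : ℤ) + ((n : ℤ) - (1 : ℕ)) * k = i + n * k by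
      push_cast; ring, hper] at h1
    push_cast at h1; linarith
  · have mono : ∀ (m : ℕ) (i : ℤ), z i + m * l ≤ z (i + (m : ℤ) * k) := by
      intro m i
      induction m with
      | zero => simp
      | succ m ih =>
        have := h (i + (m : ℤ) * k + k)
        rw [ewi] at this
        rw [show i + ((m + 1 : ℕ) : ℤ) * k = i + m * k + k by push_cast; ring]
        push_cast; linarith
    refine le_antisymm ?_ (by have := h (i + k); rwa [ewi] at this)
    have h1 := mono (n - 1) (i + k)
    rw [Nat.cast_sub hn0, Nat.cast_sub hn0, show i + (k : ℤ) + ((n : ℤ) - (1 : ℕ)) * k = i + n * k by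
      push_cast; ring, hper] at h1
    push_cast at h1; linarith

/-! ### Existence of periodic minimizers -/

theorem IsTwistFamily.bddBelow (hf : IsTwistFamily f lam) : ∃ c, ∀ j a b, -c ≤ f j a b := by
  have h1 : ∀ j : Fin r, ∃ c, ∀ a b, -c ≤ f j a b := by
    intro j
    obtain ⟨R, hR⟩ := hf.coercive j 0
    have hK : IsCompact (Set.Icc (0 : ℝ) 1 ×ˢ Set.Icc (-R - 1) (R + 1)) :=
      isCompact_Icc.prod isCompact_Icc
    obtain ⟨c, hc⟩ := hK.bddBelow_image (hf.differentiable j).continuous.continuousOn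
    refine ⟨|c|, fun a b => ?_⟩
    rcases le_or_gt R |a - b| with h | h
    · linarith [hR a b h, abs_nonneg c]
    · rw [← hf.periodic_int j a b (-⌊a⌋)]
      have e1 := Int.floor_le a
      have e2 := Int.lt_floor_add_one a
      rw [abs_lt] at h
      push_cast
      have := hc ⟨(a + -⌊a⌋, b + -⌊a⌋), ⟨⟨by simp only; linarith, by simp only; linarith⟩,
        ⟨by simp only; linarith, by simp only; linarith⟩⟩, rfl⟩
      exact (neg_abs_le c).trans this
  choose c hc using h1
  refine ⟨∑ j, |c j|, fun j a b => ?_⟩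
  have := Finset.single_le_sum (f := fun j => |c j|) (fun j _ => abs_nonneg _) (Finset.mem_univ j)
  have := hc j a b
  have := le_abs_self (c j)
  linarith

/-- The other r * Q - 1 bonds of a period cost at least -c each, so an energy bound caps each
nearest-neighbour bond, and coercivity caps its length. -/
theorem exists_bound_of_periodEnergy_le (hf : IsTwistFamily f lam) (hr : 1 ≤ r) {Q : ℕ} (hQ : 0 < Q)
    (P : ℤ) (C : ℝ) : ∃ R, ∀ w, IsPeriodicSeq Q P w → periodEnergy f 0 Q w ≤ C →
      ∀ i, |w (i + 1) - w i| ≤ R := by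
  obtain ⟨c, hc⟩ := hf.bddBelow
  obtain ⟨R, hR⟩ := hf.coercive ⟨0, hr⟩ (C + r * (Q * c) - c + 1)
  refine ⟨R, fun w hw hE i => ?_⟩
  by_contra hcon
  set t := (i % (Q : ℤ)).toNat with ht
  have hQ' : (0 : ℤ) < Q := by exact_mod_cast hQ
  have ht0 : (t : ℤ) = i % Q := Int.toNat_of_nonneg (Int.emod_nonneg _ hQ'.ne')
  have htQ : t < Q := by have := Int.emod_lt_of_pos i hQ'; omega
  have hi : i = t + i / Q * Q := by rw [ht0, mul_comm]; exact (Int.emod_add_mul_ediv i Q).symm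
  have e1 := hw.mul (i / Q) t
  have e2 := hw.mul (i / Q) (t + 1)
  rw [← hi] at e1
  rw [show (t : ℤ) + 1 + i / Q * Q = i + 1 by omega] at e2
  rw [e1, e2, add_sub_add_right_eq_sub, abs_sub_comm] at hcon
  have h1 := hR (w t) (w (t + 1)) (le_of_not_ge hcon)
  have h2 : periodEnergy f 0 Q w + r * (Q * c) =
      ∑ j : Fin r, ∑ s ∈ Finset.range Q, (f j (w (0 + s)) (w (0 + s + (j + 1))) + c) := by
    simp [periodEnergy, Finset.sum_add_distrib]
  have h3 : f ⟨0, hr⟩ (w t) (w (t + 1)) + c ≤ periodEnergy f 0 Q w + r * (Q * c) := by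
    rw [h2]
    refine le_trans ?_ (Finset.single_le_sum (fun j _ => Finset.sum_nonneg fun s _ => by
      linarith [hc j (w (0 + s)) (w (0 + s + (j + 1)))]) (Finset.mem_univ (⟨0, hr⟩ : Fin r)))
    refine le_trans (le_of_eq ?_) (Finset.single_le_sum (fun s _ => by
      linarith [hc ⟨0, hr⟩ (w (0 + s)) (w (0 + s + (((⟨0, hr⟩ : Fin r) : ℕ) + 1)))])
      (Finset.mem_range.2 htQ))
    simp
  linarith

/-- Direct method: integer vertical shifts bring z 0 into [0, 1], and bounded increments then give
compactness in the product topology. -/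
theorem exists_isPeriodicMinimizer (hf : IsTwistFamily f lam) (hr : 1 ≤ r) {Q : ℕ} (hQ : 0 < Q)
    (P : ℤ) : ∃ z, IsPeriodicMinimizer f Q P z := by
  set z₀ : ℤ → ℝ := fun i => i * (P / Q) with hz₀
  have hz₀per : IsPeriodicSeq Q P z₀ := fun i => by
    have : (Q : ℝ) ≠ 0 := by exact_mod_cast hQ.ne'
    simp only [hz₀]; push_cast; field_simp
  obtain ⟨R, hR⟩ := exists_bound_of_periodEnergy_le hf hr hQ P (periodEnergy f 0 Q z₀)
  set K : Set (ℤ → ℝ) := {z | IsPeriodicSeq Q P z ∧ z 0 ∈ Set.Icc (0 : ℝ) 1 ∧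
    ∀ i, |z (i + 1) - z i| ≤ R} with hK
  have hKc : IsCompact K := by
    refine IsCompact.of_isClosed_subset (isCompact_univ_pi fun i : ℤ =>
      isCompact_Icc (a := -(1 + i.natAbs * R)) (b := 1 + i.natAbs * R)) ?_ ?_
    · have : K = (⋂ i : ℤ, {z : ℤ → ℝ | z (i + Q) = z i + P}) ∩
          ((fun z : ℤ → ℝ => z 0) ⁻¹' Set.Icc (0 : ℝ) 1 ∩ ⋂ i, {z | |z (i + 1) - z i| ≤ R}) := by
        ext z; simp [hK, IsPeriodicSeq]
      rw [this]
      exact (isClosed_iInter fun i => isClosed_eq (by fun_prop) (by fun_prop)).inter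
        ((isClosed_Icc.preimage (continuous_apply 0)).inter
          (isClosed_iInter fun i => isClosed_le (by fun_prop) continuous_const))
    · rintro z ⟨-, ⟨h0, h1⟩, hd⟩ i -
      have : |z i - z 0| ≤ i.natAbs * R := by
        rcases Int.natAbs_eq i with h | h
        · have := abs_sub_le_of_step (N := 0) (fun i _ => hd i) le_rfl i.natAbs
          rw [abs_sub_comm]; rwa [zero_add, ← h] at this
        · have := abs_sub_le_of_step (N := i) (fun i _ => hd i) le_rfl i.natAbs
          rwa [show i + (i.natAbs : ℤ) = 0 by omega] at this
      rw [abs_le] at this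
      exact ⟨by linarith, by linarith⟩
  have hcont : Continuous (periodEnergy f 0 Q) := by
    unfold periodEnergy
    refine continuous_finsetSum _ fun j _ => continuous_finsetSum _ fun t _ => ?_
    exact (hf.differentiable j).continuous.comp (g := fun p : ℝ × ℝ => f j p.1 p.2)
      (f := fun z : ℤ → ℝ => (z (0 + t), z (0 + t + (j + 1)))) (by fun_prop)
  have hz₀K : z₀ ∈ K := ⟨hz₀per, by simp [hz₀], hR z₀ hz₀per le_rfl⟩
  obtain ⟨z, hzK, hz⟩ := hKc.exists_isMinOn ⟨z₀, hz₀K⟩ hcont.continuousOn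
  refine ⟨z, hzK.1, fun w hw => ?_⟩
  rcases le_or_gt (periodEnergy f 0 Q w) (periodEnergy f 0 Q z₀) with h | h
  · have hw' := hw.translate 0 (-⌊w 0⌋)
    have hE := periodEnergy_translate hf hw 0 (-⌊w 0⌋)
    rw [← hE]
    refine hz ⟨hw', ?_, hR _ hw' (hE.trans_le h)⟩
    have e1 := Int.floor_le (w 0)
    have e2 := Int.lt_floor_add_one (w 0)
    simp only [translate, sub_zero]
    push_cast
    exact ⟨by linarith, by linarith⟩
  · exact (hz hz₀K).trans h.le

/-- There are periodic minimizers of every rational rotation number. -/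
theorem exists_periodic_isBondMinimizer (hf : IsTwistFamily f lam) (hr : 1 ≤ r) {k : ℕ} (hk : 0 < k)
    (l : ℤ) : ∃ z, IsBondMinimizer f z ∧ IsPeriodicSeq k l z := by
  -- The factor r + 1 makes the period exceed the range, as the reduction to period k requires.
  obtain ⟨z, hz⟩ := exists_isPeriodicMinimizer hf hr (Nat.mul_pos r.succ_pos hk)
    ((r + 1 : ℕ) * l)
  have hper := hz.isPeriodicSeq hf hr (Nat.lt_of_lt_of_le r.lt_succ_self (Nat.le_mul_of_pos_right _ hk))
  refine ⟨z, fun A B y hy => ?_, hper⟩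
  rcases lt_or_ge B A with hBA | hAB
  · have : y = z := funext fun i => hy i (by omega)
    rw [this]
  set m := (B - A).toNat + 1 with hm
  have hlt : (B - A).toNat + r < m * (r + 1) * k := by
    refine Nat.lt_of_lt_of_le ?_ (Nat.le_mul_of_pos_right _ hk)
    rw [hm]; nlinarith [Nat.zero_le ((B - A).toNat * r)]
  have hlarge : r < m * (r + 1) * k := by omega
  -- A period long enough for [A, B]. Its minimizer z' also has period (k, l), so comparing energies
  -- over k sites shows that z minimizes for the long period too.
  obtain ⟨z', hz'⟩ := exists_isPeriodicMinimizer hf hr (show 0 < m * (r + 1) * k by omega)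
    ((m * (r + 1) : ℕ) * l)
  have hper' := hz'.isPeriodicSeq hf hr hlarge
  have hzz : periodEnergy f 0 k z ≤ periodEnergy f 0 k z' := by
    have h1 := hz.2 z' (by simpa using hper'.mul (r + 1 : ℕ))
    rw [Nat.succ_eq_add_one, periodEnergy_mul hf hper, periodEnergy_mul hf hper'] at h1
    exact le_of_mul_le_mul_left h1 (by positivity)
  have hzm : IsPeriodicMinimizer f (m * (r + 1) * k) ((m * (r + 1) : ℕ) * l) z := by
    refine ⟨by simpa using hper.mul (m * (r + 1) : ℕ), fun w hw => le_trans ?_ (hz'.2 w hw)⟩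
    rw [periodEnergy_mul hf hper, periodEnergy_mul hf hper']
    exact mul_le_mul_of_nonneg_left hzz (by positivity)
  exact hzm.bondEnergy_le hf hAB (by omega) hy

theorem IsPeriodicSeq.exists_bound {k : ℕ} (hk : 0 < k) {l : ℤ} {z : ℤ → ℝ}
    (hz : IsPeriodicSeq k l z) : ∃ D, ∀ i : ℤ, |z i - l / k * i| ≤ D := by
  have hk' : (0 : ℤ) < k := by exact_mod_cast hk
  have hk0 : (k : ℝ) ≠ 0 := by exact_mod_cast hk.ne'
  refine ⟨∑ t ∈ Finset.range k, |z t - l / k * t|, fun i => ?_⟩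
  set t := (i % (k : ℤ)).toNat with ht
  have ht0 : (t : ℤ) = i % k := Int.toNat_of_nonneg (Int.emod_nonneg _ hk'.ne')
  have htk : t < k := by have := Int.emod_lt_of_pos i hk'; omega
  have hi : i = t + i / k * k := by rw [ht0, mul_comm]; exact (Int.emod_add_mul_ediv i k).symm
  have e1 := hz.mul (i / k) t
  rw [← hi] at e1
  have hir : (i : ℝ) = t + (i / k : ℤ) * k := by exact_mod_cast hi
  have : z i - l / k * i = z t - l / k * t := by
    rw [e1, hir]; push_cast; field_simp; ring
  rw [this]
  exact Finset.single_le_sum (f := fun t : ℕ => |z t - l / k * t|) (fun _ _ => abs_nonneg _)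
    (Finset.mem_range.2 htk)

/-! ### Growth of sequences -/

theorem add_mul_le_of_step {x : ℤ → ℝ} {c : ℝ} {b : ℤ} (h : ∀ i ≥ b, c ≤ x i - x (i - 1))
    {i : ℤ} (hi : b ≤ i + 1) (m : ℕ) : x i + m * c ≤ x (i + m) := by
  induction m with
  | zero => simp
  | succ m ih =>
    have := h (i + (m + 1 : ℕ)) (by omega)
    rw [show i + ((m + 1 : ℕ) : ℤ) - 1 = i + m by push_cast; ring] at this
    rw [show ((m + 1 : ℕ) : ℝ) = m + 1 by push_cast; ring]
    linarith

/-- Summing u over k consecutive sites turns monotonicity along steps of k into ordinary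
monotonicity of U. The windows make U gain δ in every r steps, and the step bound L transfers this
growth to u. -/
theorem unbounded_of_windows {u : ℤ → ℝ} {k r : ℕ} (hk : 0 < k) {L δ : ℝ} {N : ℤ} (hδ : 0 < δ)
    (hu : ∀ i ≥ N, u (i - k) ≤ u i) (hL : ∀ i ≥ N, |u (i + 1) - u i| ≤ L)
    (hw : ∀ n ≥ N, ∃ i, n < i ∧ i ≤ n + r ∧ u (i - k) + δ ≤ u i) (R : ℝ) :
    ∃ M : ℤ, ∀ i ≥ M, R ≤ u i := by
  set U : ℤ → ℝ := fun n => ∑ t ∈ Finset.range k, u (n + t) with hU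
  have hstep : ∀ n, U (n + 1) - U n = u (n + k) - u n := by
    intro n
    have h1 := Finset.sum_range_succ (fun t : ℕ => u (n + t)) k
    have h2 := Finset.sum_range_succ' (fun t : ℕ => u (n + t)) k
    have h3 : ∀ t : ℕ, u (n + (t + 1 : ℕ)) = u (n + 1 + t) := fun t => by
      congr 1; push_cast; ring
    simp only [h3] at h2
    simp only [hU]
    rw [h2] at h1
    simp only [Nat.cast_zero, add_zero] at h1
    linarith
  have hmono : ∀ n ≥ N, ∀ m : ℕ, U n ≤ U (n + m) := by
    intro n hn m
    induction m with
    | zero => simp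
    | succ m ih =>
      have h1 := hstep (n + m)
      have h2 := hu (n + m + k) (by omega)
      rw [add_sub_cancel_right] at h2
      rw [show n + ((m + 1 : ℕ) : ℤ) = n + m + 1 by push_cast; ring]
      linarith
  have hjump : ∀ n ≥ N, U n + δ ≤ U (n + r) := by
    intro n hn
    -- This start puts i - k in [n, n + r), so the jump of U from i - k to i - k + 1 falls between n
    -- and n + r.
    obtain ⟨i, h1, h2, h3⟩ := hw (n + k - 1) (by omega)
    obtain ⟨s, hs⟩ := Int.eq_ofNat_of_zero_le (show 0 ≤ i - n - k by omega)
    obtain ⟨s', hs'⟩ := Int.eq_ofNat_of_zero_le (show 0 ≤ n + r - (n + s + 1) by omega)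
    have e1 := hmono n hn s
    have e2 := hmono (n + s + 1) (by omega) s'
    have e3 := hstep (n + s)
    rw [show n + (s : ℤ) + 1 + s' = n + r by omega] at e2
    rw [show n + (s : ℤ) + k = i by omega] at e3
    rw [show i - (k : ℤ) = n + s by omega] at h3
    linarith
  have hlin : ∀ m : ℕ, U N + m * δ ≤ U (N + m * r) := by
    intro m
    induction m with
    | zero => simp
    | succ m ih =>
      have h0 : (0 : ℤ) ≤ m * r := by positivity
      have := hjump (N + m * r) (by omega)
      rw [show N + ((m + 1 : ℕ) : ℤ) * r = N + m * r + r by push_cast; ring]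
      push_cast; linarith
  have hL0 : 0 ≤ L := (abs_nonneg _).trans (hL N le_rfl)
  have hUu : ∀ n ≥ N, U n ≤ k * (u n + k * L) := by
    intro n hn
    have : ∀ t ∈ Finset.range k, u (n + t) ≤ u n + k * L := by
      intro t ht
      have h1 := abs_sub_le_of_step hL hn t
      have h2 : (t : ℝ) * L ≤ k * L :=
        mul_le_mul_of_nonneg_right (by exact_mod_cast (Finset.mem_range.1 ht).le) hL0
      rw [abs_le] at h1; linarith
    exact (Finset.sum_le_card_nsmul _ _ _ this).trans
      (by rw [Finset.card_range, nsmul_eq_mul])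
  obtain ⟨m, hm⟩ := exists_nat_ge ((k * (R + k * L) - U N) / δ)
  rw [div_le_iff₀ hδ] at hm
  refine ⟨N + m * r, fun i hi => ?_⟩
  have h0 : (0 : ℤ) ≤ m * r := by positivity
  obtain ⟨s, hs⟩ := Int.eq_ofNat_of_zero_le (show 0 ≤ i - (N + m * r) by omega)
  have e1 := hmono (N + m * r) (by omega) s
  rw [show N + (m : ℤ) * r + s = i by omega] at e1
  have e2 := hUu i (by omega)
  have e3 := hlin m
  have hk0 : (0 : ℝ) < k := by exact_mod_cast hk
  have : k * (R + k * L) ≤ k * (u i + k * L) := by linarith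
  have := le_of_mul_le_mul_left this hk0
  linarith

/-- Alternative for a sequence that is eventually monotone with respect to a translation and whose
increments are eventually comparable to each integer. -/
theorem asymptotic_or_unbounded {x : ℤ → ℝ} {k : ℕ} (hk : 0 < k) (r : ℕ) {c : ℝ}
    (hc : ∃ b, ∀ i ≥ b, c ≤ x i - x (i - k))
    (hd : ∀ m : ℤ, (∃ b, ∀ i ≥ b, (m : ℝ) ≤ x i - x (i - 1)) ∨
      ∃ b, ∀ i ≥ b, x i - x (i - 1) ≤ (m : ℝ)) :
    (∃ (C : ℝ) (N₀ : ℤ), (∀ i ≥ N₀, |x i - x (i - k) - c| ≤ C) ∧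
      (∀ i ≥ N₀, |x (i + 1) - x i| ≤ C) ∧
      ∀ δ > 0, ∀ N : ℤ, ∃ n ≥ N, ∀ i, n < i → i ≤ n + r → |x i - x (i - k) - c| ≤ δ) ∨
    ∀ R : ℝ, ∃ N : ℤ, ∀ i ≥ N, R ≤ x i - c / k * i := by
  have hk0 : (0 : ℝ) < k := by exact_mod_cast hk
  -- Either the increments eventually exceed every integer, so growth is superlinear, or they are
  -- eventually bounded above.
  by_cases H : ∀ m : ℤ, ∃ b, ∀ i ≥ b, (m : ℝ) ≤ x i - x (i - 1)
  · right
    intro R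
    obtain ⟨b, hb⟩ := H (⌈c / k⌉ + 1)
    have hb' : ∀ i ≥ b, c / k + 1 ≤ x i - x (i - 1) := fun i hi => by
      have h1 := hb i hi
      have h2 := Int.le_ceil (c / k)
      push_cast at h1; linarith
    obtain ⟨m₀, hm₀⟩ := exists_nat_ge (R - x b + c / k * b)
    refine ⟨b + m₀, fun i hi => ?_⟩
    obtain ⟨s, hs⟩ := Int.eq_ofNat_of_zero_le (show 0 ≤ i - b by omega)
    have h1 := add_mul_le_of_step hb' (show b ≤ b + 1 by omega) s
    have h2 : i = b + s := by omega
    have h3 : (m₀ : ℝ) ≤ s := by exact_mod_cast (by omega : m₀ ≤ s)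
    rw [h2]; push_cast; linarith
  · push Not at H
    obtain ⟨m, hm⟩ := H
    obtain ⟨b₁, hup⟩ := (hd m).resolve_left (by push Not; exact hm)
    obtain ⟨b₀, hc⟩ := hc
    -- Otherwise the increments are eventually at most c / k - 1, and k of them sum to at most c - k
    -- < c.
    obtain ⟨b₂, hlow⟩ : ∃ b, ∀ i ≥ b, ((⌊c / k⌋ - 1 : ℤ) : ℝ) ≤ x i - x (i - 1) := by
      refine (hd (⌊c / k⌋ - 1)).resolve_right ?_
      rintro ⟨b, hb⟩
      have hb' : ∀ i ≥ b, -(c / k - 1) ≤ (-x) i - (-x) (i - 1) := fun i hi => by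
        have h1 := hb i hi
        have h2 := Int.floor_le (c / k)
        push_cast at h1; simp only [Pi.neg_apply]; linarith
      have h1 := add_mul_le_of_step hb' (i := max b b₀) (by omega) k
      have h2 := hc (max b b₀ + k) (by omega)
      rw [add_sub_cancel_right] at h2
      simp only [Pi.neg_apply] at h1
      have h3 : (k : ℝ) * -(c / k - 1) = -c + k := by field_simp; ring
      linarith
    set L := max |(m : ℝ)| |((⌊c / k⌋ - 1 : ℤ) : ℝ)| with hLdef
    have hL0 : 0 ≤ L := (abs_nonneg _).trans (le_max_left _ _)
    set N₀ := max (max b₁ b₂) b₀ with hN₀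
    have hstep : ∀ i ≥ N₀, |x (i + 1) - x i| ≤ L := by
      intro i hi
      have h1 := hup (i + 1) (by omega)
      have h2 := hlow (i + 1) (by omega)
      rw [add_sub_cancel_right] at h1 h2
      rw [abs_le]
      exact ⟨by linarith [neg_abs_le ((⌊c / k⌋ - 1 : ℤ) : ℝ),
        le_max_right |(m : ℝ)| |((⌊c / k⌋ - 1 : ℤ) : ℝ)|],
        h1.trans ((le_abs_self _).trans (le_max_left _ _))⟩
    have hpos : ∀ i ≥ N₀, 0 ≤ x i - x (i - k) - c := fun i hi => by
      linarith [hc i (by omega)]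
    -- If windows of small excess do not recur, every late window of r sites contains an excess
    -- above some fixed δ.
    by_cases hw : ∀ δ > 0, ∀ N : ℤ, ∃ n ≥ N, ∀ i, n < i → i ≤ n + r → |x i - x (i - k) - c| ≤ δ
    · left
      refine ⟨k * L + L + |c|, N₀ + k, fun i hi => ?_, fun i hi => ?_, hw⟩
      · have h1 := abs_sub_le_of_step hstep (show N₀ ≤ i - k by omega) k
        rw [sub_add_cancel, abs_sub_comm] at h1
        have := abs_sub (x i - x (i - k)) c
        linarith
      · have := hstep i (by omega)
        have : 0 ≤ k * L := by positivity
        linarith [abs_nonneg c]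
    · right
      push Not at hw
      obtain ⟨δ, hδ, N, hw⟩ := hw
      have hdiff : ∀ i : ℤ, (x i - c / k * i) - (x (i - k) - c / k * (i - k : ℤ)) =
          x i - x (i - k) - c := fun i => by
        push_cast; field_simp; ring
      refine unbounded_of_windows (u := fun i : ℤ => x i - c / k * i) (N := max N N₀)
        (L := L + |c / k|) hk hδ (fun i hi => ?_) (fun i hi => ?_) (fun n hn => ?_) (r := r)
      · have h1 := hpos i (by omega)
        have h2 := hdiff i
        linarith
      · have h1 := hstep i (by omega)
        have h2 := abs_sub (x (i + 1) - x i) (c / k)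
        have h3 : x (i + 1) - c / k * (i + 1 : ℤ) - (x i - c / k * i) = x (i + 1) - x i - c / k := by
          push_cast; ring
        rw [h3]; linarith
      · obtain ⟨i, h1, h2, h3⟩ := hw n (by omega)
        refine ⟨i, h1, h2, ?_⟩
        rw [abs_of_nonneg (hpos i (by omega))] at h3
        have := hdiff i
        linarith

/-! ### Minimizers with finite domains of crossing -/

/-- Each integer eventually bounds the increments of `x` near `±∞` from one side. -/
def HasComparableIncrements (x : ℤ → ℝ) : Prop :=
  (∀ m : ℤ, (∃ b, ∀ i ≥ b, (m : ℝ) ≤ x i - x (i - 1)) ∨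
    ∃ b, ∀ i ≥ b, x i - x (i - 1) ≤ (m : ℝ)) ∧
  ∀ m : ℤ, (∃ b, ∀ i ≤ b, (m : ℝ) ≤ x i - x (i - 1)) ∨
    ∃ b, ∀ i ≤ b, x i - x (i - 1) ≤ (m : ℝ)

theorem HasComparableIncrements.neg {x : ℤ → ℝ} (h : HasComparableIncrements x) :
    HasComparableIncrements (-x) := by
  refine ⟨fun m => ?_, fun m => ?_⟩
  · rcases h.1 (-m) with ⟨b, hb⟩ | ⟨b, hb⟩
    · exact .inr ⟨b, fun i hi => by
        have := hb i hi; push_cast at this; simp only [Pi.neg_apply]; linarith⟩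
    · exact .inl ⟨b, fun i hi => by
        have := hb i hi; push_cast at this; simp only [Pi.neg_apply]; linarith⟩
  · rcases h.2 (-m) with ⟨b, hb⟩ | ⟨b, hb⟩
    · exact .inr ⟨b, fun i hi => by
        have := hb i hi; push_cast at this; simp only [Pi.neg_apply]; linarith⟩
    · exact .inl ⟨b, fun i hi => by
        have := hb i hi; push_cast at this; simp only [Pi.neg_apply]; linarith⟩

/-- A minimizer that is below its translate near `-∞` and above it near `+∞` is ordered with respect
to this translate. -/
theorem ordered_of_le_left_of_ge_right (hf : IsTwistFamily f lam) (hr : 1 ≤ r) {x : ℤ → ℝ}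
    (hx : IsBondMinimizer f x) (hd : HasComparableIncrements x) {k : ℕ} (hk : 0 < k) {l : ℤ}
    (hleft : ∃ a, ∀ i ≤ a, x i ≤ translate k l x i)
    (hright : ∃ b, ∀ i ≥ b, translate k l x i ≤ x i) :
    translate k l x ≤ x ∨ x ≤ translate k l x := by
  have hy := hx.translate hf k l
  obtain ⟨a, ha⟩ := hleft
  obtain ⟨b, hb⟩ := hright
  have ey : ∀ i, translate k l x i = x (i - k) + l := fun i => rfl
  have edist : ∀ i, |x i - translate k l x i| = |x i - x (i - k) - l| := fun i => by
    rw [ey, sub_add_eq_sub_sub]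
  rcases asymptotic_or_unbounded hk r (c := l)
    ⟨b, fun i hi => by have := hb i hi; rw [ey] at this; linarith⟩ hd.1 with h | hR
  · obtain ⟨C, N₀, h1, h2, h3⟩ := h
    exact .inr (le_of_asymptotic_right hf hr hx hy (a := a) (fun i hi => ha i hi.le)
      (fun i hi => (edist i).trans_le (h1 i hi)) h2
      fun δ hδ N => by
        obtain ⟨n, hn, h⟩ := h3 δ hδ N
        exact ⟨n, hn, fun i hi hi' => (edist i).trans_le (h i hi hi')⟩)
  -- The left end, seen through i ↦ -i, which turns the order there into the same kind of lower
  -- bound with slope -l / k.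
  rcases asymptotic_or_unbounded (x := fun i => x (-i)) hk r (c := -l)
    ⟨k - a, fun i hi => by
      have := ha (-(i - k)) (by omega)
      rw [ey, show -(i - (k : ℤ)) - k = -i by ring] at this
      linarith⟩
    (fun m => by
      have e : ∀ i : ℤ, x (-i) - x (-(i - 1)) = -(x (-i + 1) - x (-i + 1 - 1)) := fun i => by
        rw [add_sub_cancel_right, show -(i - 1) = -i + 1 by ring]; ring
      rcases hd.2 (-m) with ⟨b, hb⟩ | ⟨b, hb⟩
      · refine .inr ⟨1 - b, fun i hi => ?_⟩
        have := hb (-i + 1) (by omega)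
        rw [e]; push_cast at this; linarith
      · refine .inl ⟨1 - b, fun i hi => ?_⟩
        have := hb (-i + 1) (by omega)
        rw [e]; push_cast at this; linarith) with h | hL
  · obtain ⟨C, N₀, h1, h2, h3⟩ := h
    have e : ∀ i, |translate k l x i - x i| = |x (-(k - i)) - x (-(k - i - k)) - -l| := fun i => by
      rw [ey, show -((k : ℤ) - i) = i - k by ring, show -((k : ℤ) - i - k) = i by ring]
      congr 1; ring
    refine .inl (le_of_asymptotic_left hf hr hy hx (b := b) (fun i hi => hb i (le_of_lt hi))
      (N₀ := -N₀) (fun i hi => (e i).trans_le (h1 (k - i) (by omega)))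
      (fun i hi => ?_) fun δ hδ N => ?_)
    · have := h2 (k - i) (by omega)
      rw [ey, ey, add_sub_add_right_eq_sub]
      rwa [show -((k : ℤ) - i + 1) = i - 1 - k by ring, show -((k : ℤ) - i) = i - k by ring] at this
    · obtain ⟨n, hn, h⟩ := h3 δ hδ (k - N)
      exact ⟨k - n, by omega, fun i hi hi' => (e i).trans_le (h (k - i) (by omega) (by omega))⟩
  -- Now x i - l / k * i tends to +∞ at both ends. Choosing n > x 0 - z 0 makes the resulting
  -- comparison z + n ≤ x fail at 0.
  exfalso
  obtain ⟨z, hz, hper⟩ := exists_periodic_isBondMinimizer hf hr hk l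
  obtain ⟨D, hD⟩ := hper.exists_bound hk
  obtain ⟨n, hn⟩ := exists_int_gt (x 0 - z 0)
  obtain ⟨N₁, hN₁⟩ := hR (D + n)
  obtain ⟨N₂, hN₂⟩ := hL (D + n)
  have key : ∀ i : ℤ, D + n ≤ x i - l / k * i → translate 0 n z i ≤ x i := fun i hi => by
    have := (abs_le.1 (hD i)).2
    simp only [translate, sub_zero]; linarith
  have := le_of_le_off_finite hf hr (hz.translate hf 0 n) hx (a := -N₂) (b := N₁)
    (fun i hi => key i (by
      have := hN₂ (-i) (by omega)
      rw [neg_neg] at this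
      refine this.trans (le_of_eq ?_)
      push_cast; ring)) (fun i hi => key i (hN₁ i (le_of_lt hi))) 0
  simp only [translate, sub_zero] at this
  linarith

/-! ### Sign symmetry and the Birkhoff property -/

/-- The family describing the sequences `-x`. -/
theorem IsTwistFamily.neg (hf : IsTwistFamily f lam) :
    IsTwistFamily (fun j a b => f j (-a) (-b)) lam where
  differentiable j := (hf.differentiable j).comp (g := fun p : ℝ × ℝ => f j p.1 p.2)
    (f := fun p : ℝ × ℝ => (-p.1, -p.2)) (by fun_prop)
  periodic j a b := by
    have := hf.periodic_int j (-a) (-b) (-1)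
    push_cast at this
    rw [← this]; congr 1 <;> ring
  coercive j C := by
    obtain ⟨R, hR⟩ := hf.coercive j C
    exact ⟨R, fun a b h => hR _ _ (by rwa [neg_sub_neg, abs_sub_comm])⟩
  pos := hf.pos
  twist j a b h k hh hk := by
    have := hf.twist j (-(a + h)) (-(b + k)) h k hh hk
    rw [show -(a + h) + h = -a by ring, show -(b + k) + k = -b by ring] at this
    linarith

theorem IsBondMinimizer.neg {x : ℤ → ℝ} (hx : IsBondMinimizer f x) :
    IsBondMinimizer (fun j a b => f j (-a) (-b)) (-x) := by
  intro A B y hy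
  have h := hx A B (-y) fun i hi => by simp [hy i hi]
  simpa [bondEnergy] using h

theorem translate_neg (k l : ℤ) (x : ℤ → ℝ) : translate k l (-x) = -translate k (-l) x := by
  funext i
  simp only [translate, Pi.neg_apply]; push_cast; ring

theorem isBirkhoff_of_eventually_ordered (hf : IsTwistFamily f lam) (hr : 1 ≤ r) {x : ℤ → ℝ}
    (hx : IsBondMinimizer f x)
    (hL : ∀ k l : ℤ, (∃ a, ∀ i ≤ a, x i ≤ translate k l x i) ∨ ∃ a, ∀ i ≤ a, translate k l x i ≤ x i)
    (hR : ∀ k l : ℤ, (∃ b, ∀ i ≥ b, x i ≤ translate k l x i) ∨ ∃ b, ∀ i ≥ b, translate k l x i ≤ x i) :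
    IsBirkhoff x := by
  -- The order relative to τ_{1,m} x is exactly a comparison of increments with m.
  have hd : HasComparableIncrements x := by
    refine ⟨fun m => ?_, fun m => ?_⟩
    · rcases hR 1 m with ⟨b, hb⟩ | ⟨b, hb⟩
      · exact .inr ⟨b, fun i hi => by have := hb i hi; simp only [translate] at this; linarith⟩
      · exact .inl ⟨b, fun i hi => by have := hb i hi; simp only [translate] at this; linarith⟩
    · rcases hL 1 m with ⟨b, hb⟩ | ⟨b, hb⟩
      · exact .inr ⟨b, fun i hi => by have := hb i hi; simp only [translate] at this; linarith⟩
      · exact .inl ⟨b, fun i hi => by have := hb i hi; simp only [translate] at this; linarith⟩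
  have pos : ∀ (k : ℕ) (l : ℤ), 0 < k → translate k l x ≤ x ∨ x ≤ translate k l x := by
    intro k l hk
    have hy := hx.translate hf k l
    rcases hL k l with ⟨a, ha⟩ | ⟨a, ha⟩ <;> rcases hR k l with ⟨b, hb⟩ | ⟨b, hb⟩
    · exact .inr (le_of_le_off_finite hf hr hx hy (fun i hi => ha i (le_of_lt hi))
        fun i hi => hb i (le_of_lt hi))
    · exact ordered_of_le_left_of_ge_right hf hr hx hd hk ⟨a, ha⟩ ⟨b, hb⟩
    · have := ordered_of_le_left_of_ge_right hf.neg hr hx.neg hd.neg hk (l := -l)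
        ⟨a, fun i hi => by rw [translate_neg, neg_neg]; exact neg_le_neg (ha i hi)⟩
        ⟨b, fun i hi => by rw [translate_neg, neg_neg]; exact neg_le_neg (hb i hi)⟩
      rw [translate_neg, neg_neg, neg_le_neg_iff, neg_le_neg_iff] at this
      exact this.symm
    · exact .inl (le_of_le_off_finite hf hr hy hx (fun i hi => ha i (le_of_lt hi))
        fun i hi => hb i (le_of_lt hi))
  intro k l
  rcases lt_trichotomy k 0 with hk | rfl | hk
  · obtain ⟨n, hn⟩ := Int.eq_ofNat_of_zero_le (show 0 ≤ -k by omega)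
    rcases pos n (-l) (by omega) with h | h
    · refine .inr fun i => ?_
      have := h (i - k)
      simp only [translate] at this ⊢
      rw [show i - k - (n : ℤ) = i by omega] at this
      push_cast at this; linarith
    · refine .inl fun i => ?_
      have := h (i - k)
      simp only [translate] at this ⊢
      rw [show i - k - (n : ℤ) = i by omega] at this
      push_cast at this; linarith
  · rcases le_total l 0 with h | h
    · exact .inl fun i => by
        have : (l : ℝ) ≤ 0 := by exact_mod_cast h
        simp only [translate, sub_zero]; linarith
    · exact .inr fun i => by
        have : (0 : ℝ) ≤ l := by exact_mod_cast h
        simp only [translate, sub_zero]; linarith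
  · obtain ⟨n, rfl⟩ := Int.eq_ofNat_of_zero_le hk.le
    exact pos n l (by omega)

/-! ### Passage from the local energy and domains of crossing -/

theorem exists_isTwistFamily {S : (Fin (r + 1) → ℝ) → ℝ} (hS : IsLocalEnergy r S) :
    ∃ (f : Fin r → ℝ → ℝ → ℝ) (lam : ℝ), IsTwistFamily f lam ∧
      ∀ ξ, S ξ = ∑ j : Fin r, f j (ξ 0) (ξ j.succ) := by
  obtain ⟨-, -, f, hf, hSf, hper, -, hco, lam, hlam, ht⟩ := hS
  refine ⟨f, lam, ⟨fun j => (hf j).differentiable (by norm_num), hper, fun j C => ?_, hlam,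
    fun j => twist_of_pderiv (hf j) (ht j)⟩, hSf⟩
  have h := (tendsto_atTop.1 (hco j)) C
  rw [eventually_comap] at h
  obtain ⟨R, hR⟩ := eventually_atTop.1 h
  exact ⟨R, fun a b hab => hR _ hab (a, b) rfl⟩

/-- The energy over [A - r, B] also counts bonds ending before A, but these cancel in differences
for variations supported in [A, B]. -/
theorem IsGlobalMinimizer.isBondMinimizer {S : (Fin (r + 1) → ℝ) → ℝ}
    (hSf : ∀ ξ, S ξ = ∑ j : Fin r, f j (ξ 0) (ξ j.succ)) {x : ℤ → ℝ}
    (hx : IsGlobalMinimizer S x) : IsBondMinimizer f x := by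
  intro A B y hy
  rcases lt_or_ge B A with hBA | hAB
  · have : y = x := funext fun i => hy i (by omega)
    rw [this]
  have h := hx A B hAB (y - x) fun i hi => by
    by_contra hc
    rw [Set.mem_Icc] at hc
    exact hi (by simp [hy i (by omega)])
  rw [add_sub_cancel] at h
  have e : ∀ w, energyOn S (Finset.Icc (A - r) B) w =
      ∑ j : Fin r, ∑ i ∈ Finset.Icc (A - r) B, f j (w i) (w (i + (j + 1))) := by
    intro w
    rw [Finset.sum_comm]
    refine Finset.sum_congr rfl fun i _ => ?_
    simp [siteEnergy, hSf]
  have h2 := sum_sub_eq_bondEnergy_sub (f := f) (Finset.Icc (A - r) B) (fun j =>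
    Finset.Icc_subset_Icc (by have := j.2; omega) le_rfl) hy
  rw [← e, ← e] at h2
  linarith

theorem eventually_ordered_of_isDomainOfCrossing {x y : ℤ → ℝ} {D : Set ℤ}
    (hD : IsDomainOfCrossing x y D) (hfin : D.Finite) :
    ((∃ a, ∀ i ≤ a, x i ≤ y i) ∨ ∃ a, ∀ i ≤ a, y i ≤ x i) ∧
      ((∃ b, ∀ i ≥ b, x i ≤ y i) ∨ ∃ b, ∀ i ≥ b, y i ≤ x i) := by
  obtain ⟨-, hl, hu⟩ := hD.prop
  obtain ⟨a, ha⟩ := hfin.bddBelow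
  obtain ⟨b, hb⟩ := hfin.bddAbove
  have ha' : ∀ i ≤ a, i ∈ lowerBounds D := fun i hi => lowerBounds_mono_mem hi ha
  have hb' : ∀ i ≥ b, i ∈ upperBounds D := fun i hi => upperBounds_mono_mem hi hb
  exact ⟨hl.imp (fun h => ⟨a, fun i hi => h i (ha' i hi)⟩) fun h => ⟨a, fun i hi => h i (ha' i hi)⟩,
    hu.imp (fun h => ⟨b, fun i hi => h i (hb' i hi)⟩) fun h => ⟨b, fun i hi => h i (hb' i hi)⟩⟩

theorem isDomainOfCrossing_empty {x y : ℤ → ℝ} (h : y ≤ x ∨ x ≤ y) :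
    IsDomainOfCrossing x y ∅ := by
  have ho : ∀ A, OrderedOn x y A := fun A =>
    h.symm.imp (fun h i _ => h i) fun h i _ => h i
  exact ⟨⟨Set.ordConnected_empty, ho _, ho _⟩, fun E _ _ => Set.empty_subset E⟩

end MonotoneRecurrence

theorem mainTheorem2 (r : ℕ) (S : (Fin (r + 1) → ℝ) → ℝ)
    (hS : MonotoneRecurrence.IsLocalEnergy r S) :
    (∀ x ∈ MonotoneRecurrence.almostBirkhoffMinimizers S, MonotoneRecurrence.IsBirkhoff x) ∧
      MonotoneRecurrence.almostBirkhoffMinimizers S =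
        MonotoneRecurrence.birkhoffMinimizers S := by
  obtain ⟨f, lam, hf, hSf⟩ := MonotoneRecurrence.exists_isTwistFamily hS
  have key : ∀ x ∈ MonotoneRecurrence.almostBirkhoffMinimizers S,
      MonotoneRecurrence.IsBirkhoff x := by
    rintro x ⟨hx, hD⟩
    have h : ∀ k l : ℤ, _ := fun k l =>
      (hD k l).elim fun D h =>
        MonotoneRecurrence.eventually_ordered_of_isDomainOfCrossing h.1 h.2
    exact MonotoneRecurrence.isBirkhoff_of_eventually_ordered hf hS.1
      (hx.isBondMinimizer hSf) (fun k l => (h k l).1) fun k l => (h k l).2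
  refine ⟨key, Set.Subset.antisymm (fun x hx => ⟨hx.1, key x hx⟩) ?_⟩
  rintro x ⟨hx, hB⟩
  exact ⟨hx, fun k l => ⟨∅, MonotoneRecurrence.isDomainOfCrossing_empty (hB k l),
    Set.finite_empty⟩⟩
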